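/- Let $\nu$ be a positive integer, let $C=\binom{\nu+2}{2}$, and let $q$ be a complex number with $|q|<1$. Write $(a;q)_n=\prod_{k=0}^{n-1}(1-aq^k)$, $(a;q)_\infty=\lim_{n\to\infty}(a;q)_n$, $(a_1,\dots,a_r;q)_\infty=(a_1;q)_\infty\cdots(a_r;q)_\infty$, and, for integers $A,B$, $$\begin{bmatrix}A\\B\end{bmatrix}_q=\frac{(q;q)_A}{(q;q)_B\,(q;q)_{A-B}}\ \text{ if } B\ge 0 \text{ and } A-B\ge 0,\qquad \begin{bmatrix}A\\B\end{bmatrix}_q=0\ \text{ otherwise.}$$ For non-negative integers $n_1,\dots,n_\nu$ put $N_k=n_k+n_{k+1}+\dots+n_\nu$ $(1\le k\le\nu)$. Then $$\sum_{\substack{i,m,n_1,\dots,n_\nu\ge 0\\ i+m\equiv N_1+\dots+N_\nu\ (\mathrm{mod}\ 2)}} \frac{q^{\frac{m^2+3(i^2+N_1^2+\dots+N_\nu^2)}{2}}}{(q^3;q^3)_i} \begin{bmatrix}3n_\nu\\ m\end{bmatrix}_{q} \begin{bmatrix}2n_\nu+\frac{i-N_1-\dots-N_\nu-m}{2}\\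 2n_\nu\end{bmatrix}_{q^3} \prod_{j=1}^{\nu-1}\begin{bmatrix}i-\sum_{k=1}^{j}N_k+n_j\\ n_j\end{bmatrix}_{q^3}$$ $$=\frac{\left(q^{6C},\,-q^{3C+1},\,-q^{3C-1};\,q^{6C}\right)_\infty}{(q^3;q^3)_\infty},$$ where the series on the left converges absolutely. -/

import Mathlib

namespace CapparelliHierarchy

open Filter Topology

/-- The finite `q`-Pochhammer symbol `(a; q)_n = (1 - a)(1 - a q) ⋯ (1 - a q^(n-1))`. -/
noncomputable def qPoch (a q : ℂ) (n : ℕ) : ℂ :=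
  ∏ k ∈ Finset.range n, (1 - a * q ^ k)

/-- The infinite `q`-Pochhammer symbol `(a; q)_∞`. For `|q| < 1` it is the limit of `(a; q)_n`
as `n → ∞`, see `tendsto_qPoch`. -/
noncomputable def qPochInf (a q : ℂ) : ℂ :=
  ∏' k : ℕ, (1 - a * q ^ k)

theorem tendsto_qPoch (a q : ℂ) (hq : ‖q‖ < 1) :
    Tendsto (fun n : ℕ => qPoch a q n) atTop (𝓝 (qPochInf a q)) := by
  have hs : Summable fun k : ℕ => ‖-(a * q ^ k)‖ := by
    simp only [norm_neg, norm_mul, norm_pow]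
    exact (summable_geometric_of_lt_one (norm_nonneg q) hq).mul_left _
  have hm : Multipliable fun k : ℕ => (1 - a * q ^ k) := by
    simpa only [sub_eq_add_neg] using multipliable_one_add_of_summable hs
  exact hm.hasProd.tendsto_prod_nat

/-- The `q`-binomial coefficient `[A choose B]_q`, for integers `A` and `B`: it equals
`(q; q)_A / ((q; q)_B (q; q)_(A - B))` if `B ≥ 0` and `A - B ≥ 0`, and it is `0` otherwise. -/
noncomputable def qBinom (q : ℂ) (A B : ℤ) : ℂ :=
  if 0 ≤ B ∧ 0 ≤ A - B then
    qPoch q q A.toNat / (qPoch q q B.toNat * qPoch q q (A - B).toNat)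
  else 0

/-- The entry `n_k` of the tuple `n = (n_1, …, n_ν)`, for `1 ≤ k ≤ ν` (and `0` for other `k`). -/
def entry {ν : ℕ} (n : Fin ν → ℕ) (k : ℕ) : ℕ :=
  if h : 1 ≤ k ∧ k ≤ ν then n ⟨k - 1, by omega⟩ else 0

/-- `N_k = n_k + n_(k+1) + ⋯ + n_ν`. -/
def tailSum {ν : ℕ} (n : Fin ν → ℕ) (k : ℕ) : ℕ :=
  ∑ l ∈ Finset.Icc k ν, entry n l

/-- `N_1 + N_2 + ⋯ + N_j`. -/
def sumTails {ν : ℕ} (n : Fin ν → ℕ) (j : ℕ) : ℕ :=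
  ∑ k ∈ Finset.Icc 1 j, tailSum n k

/-- The range of summation: all `(i, m, n_1, …, n_ν)` of non-negative integers with
`i + m ≡ N_1 + ⋯ + N_ν (mod 2)`. -/
def indexSet (ν : ℕ) : Set (ℕ × ℕ × (Fin ν → ℕ)) :=
  {p | p.1 + p.2.1 ≡ sumTails p.2.2 ν [MOD 2]}

/-- The number `m² + 3 (i² + N_1² + ⋯ + N_ν²)`, twice the exponent of `q` in the summand. -/
def twiceExponent {ν : ℕ} (i m : ℕ) (n : Fin ν → ℕ) : ℕ :=
  m ^ 2 + 3 * (i ^ 2 + ∑ k ∈ Finset.Icc 1 ν, tailSum n k ^ 2)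

/-- On the range of summation the exponent of `q` is an integer. -/
theorem two_dvd_twiceExponent {ν : ℕ} {i m : ℕ} {n : Fin ν → ℕ}
    (h : (i, m, n) ∈ indexSet ν) : 2 ∣ twiceExponent i m n := by
  have sq : ∀ x : ZMod 2, x ^ 2 = x := by decide
  have three : (3 : ZMod 2) = 1 := by decide
  have h' : ((i + m : ℕ) : ZMod 2) = ((sumTails n ν : ℕ) : ZMod 2) :=
    (ZMod.natCast_eq_natCast_iff _ _ _).2 h
  rw [← ZMod.natCast_eq_zero_iff]
  simp only [twiceExponent, sumTails] at h' ⊢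
  push_cast at h' ⊢
  simp only [sq, three, one_mul]
  rw [← h']
  linear_combination (CharTwo.add_self_eq_zero (i : ZMod 2)) +
    (CharTwo.add_self_eq_zero (m : ZMod 2))

/-- On the range of summation `i - N_1 - ⋯ - N_ν - m` is even. -/
theorem two_dvd_sub {ν : ℕ} {i m : ℕ} {n : Fin ν → ℕ} (h : (i, m, n) ∈ indexSet ν) :
    (2 : ℤ) ∣ (i : ℤ) - sumTails n ν - m := by
  have h' : (i + m) % 2 = sumTails n ν % 2 := h
  omega

/-- The summand. Both divisions by `2` are exact on the range of summation. The `q`-binomial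
coefficients have integer arguments; in particular they vanish where the upper argument is
negative. -/
noncomputable def summand {ν : ℕ} (q : ℂ) (i m : ℕ) (n : Fin ν → ℕ) : ℂ :=
  q ^ (twiceExponent i m n / 2) / qPoch (q ^ 3) (q ^ 3) i
    * qBinom q (3 * entry n ν) m
    * qBinom (q ^ 3) (2 * entry n ν + ((i : ℤ) - sumTails n ν - m) / 2) (2 * entry n ν)
    * ∏ j ∈ Finset.Icc 1 (ν - 1),
        qBinom (q ^ 3) ((i : ℤ) - sumTails n j + entry n j) (entry n j)

end CapparelliHierarchy

/-! Write q = s² and σ = s³, so that q³ = σ². The proof is a Bailey-type iteration for refined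
q-trinomial coefficients. `tau σ L M a b` is the coefficient of z^L x^(-a) in (-zσ; σ²)_M / ((zx;
σ²)_(M+b+1) (z/x; σ²)_(M-b+1)). Three facts carry the argument.

Transformation (`tauSum_eq`): summing `tau` at (L - i, i, a, b) over i with weight σ^(i²) [L+M-i;
M-i] gives σ^(b²) times `tau` at (L, M, a+b, b). Both sides obey the same second-order recursion in
M, which also lowers b and L. The recursion is read off from polynomial identities between
generating functions.

Seed (`sum_wt_mul_tau`): the sum over m for a single n equals the sum over integers j of s^(3j²+2j)
times `tau` at a = b = |j|. The factors of (-sz; s²)_(3M) are sorted by residue modulo 3: one class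
is the numerator of `tau`, and the other two combine with the remaining binomial by a
q-Pfaff-Saalschütz sum.

Limits: as M → ∞ the transformation produces the factor 1/(q³; q³)_i (`sum_tau_eq_tauInf`). The
remaining sum over i is evaluated by using the Durfee rectangle identity twice (`hasSum_tauTerm`).

In the multisum, N_1 enters the other factors only through i - N_1 (`core_cons`). Hence, starting
from the seed, each further n_k is summed by one use of the transformation, which adds |j| to a and
3j² to the exponent of s. The sum over N_1 uses the limiting form, and the sum over i leaves
σ^(a²)/(q³; q³)_∞ with a = (ν+1)|j|, for ν as in the main theorem. The exponents of s add up to 6Cj²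
+ 2j, so the series over j is a theta series, and Jacobi's triple product (`hasSum_theta`) finishes.
-/

namespace CapparelliHierarchy

open Filter Topology
open Finset.HasAntidiagonal (antidiagonal mem_antidiagonal)

/-! ### Gaussian binomials and their summation formulas -/

/-- The Gaussian binomial coefficient, defined by its Pascal recursion. -/
noncomputable def gauss (p : ℂ) : ℕ → ℕ → ℂ
  | _, 0 => 1
  | 0, _ + 1 => 0
  | n + 1, k + 1 => p ^ (n - k) * gauss p n k + gauss p n (k + 1)

@[simp] theorem gauss_zero_right (p : ℂ) (n : ℕ) : gauss p n 0 = 1 := by cases n <;> rfl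

@[simp] theorem gauss_zero_succ (p : ℂ) (k : ℕ) : gauss p 0 (k + 1) = 0 := rfl

theorem gauss_succ_succ (p : ℂ) (n k : ℕ) :
    gauss p (n + 1) (k + 1) = p ^ (n - k) * gauss p n k + gauss p n (k + 1) := rfl

theorem gauss_of_lt (p : ℂ) {n k : ℕ} (h : n < k) : gauss p n k = 0 := by
  induction n generalizing k with
  | zero => obtain ⟨k, rfl⟩ := Nat.exists_eq_succ_of_ne_zero h.ne'; rfl
  | succ n ih =>
    obtain ⟨k, rfl⟩ := Nat.exists_eq_succ_of_ne_zero (Nat.ne_zero_of_lt h)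
    rw [Nat.succ_eq_add_one, gauss_succ_succ, ih (by omega), ih (by omega)]; ring

@[simp] theorem gauss_self (p : ℂ) (n : ℕ) : gauss p n n = 1 := by
  induction n with
  | zero => simp
  | succ n ih => rw [gauss_succ_succ, ih, gauss_of_lt p (by omega)]; simp

theorem qPoch_zero (a q : ℂ) : qPoch a q 0 = 1 := by simp [qPoch]

theorem qPoch_succ (a q : ℂ) (n : ℕ) : qPoch a q (n + 1) = qPoch a q n * (1 - a * q ^ n) := by
  simp [qPoch, Finset.prod_range_succ]

theorem qPoch_self_succ (p : ℂ) (n : ℕ) :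
    qPoch p p (n + 1) = qPoch p p n * (1 - p ^ (n + 1)) := by
  rw [qPoch_succ, pow_succ']

theorem one_sub_pow_succ_ne_zero {p : ℂ} (hp : ‖p‖ < 1) (n : ℕ) : 1 - p ^ (n + 1) ≠ 0 := by
  intro h
  have h1 : ‖p ^ (n + 1)‖ = 1 := by rw [← sub_eq_zero.1 h]; simp
  rw [norm_pow] at h1
  exact absurd h1 (pow_lt_one₀ (norm_nonneg p) hp (Nat.succ_ne_zero n)).ne

theorem qPoch_self_ne_zero {p : ℂ} (hp : ‖p‖ < 1) (n : ℕ) : qPoch p p n ≠ 0 := by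
  induction n with
  | zero => simp [qPoch_zero]
  | succ n ih => rw [qPoch_self_succ]; exact mul_ne_zero ih (one_sub_pow_succ_ne_zero hp n)

theorem gauss_mul_qPoch (p : ℂ) (k d : ℕ) :
    gauss p (k + d) k * (qPoch p p k * qPoch p p d) = qPoch p p (k + d) := by
  induction h : k + d generalizing k d with
  | zero =>
    obtain ⟨rfl, rfl⟩ : k = 0 ∧ d = 0 := by omega
    simp [qPoch_zero]
  | succ n ih =>
    rcases k with _ | k
    · obtain rfl : d = n + 1 := by omega
      simp [qPoch_zero]
    rcases d with _ | d
    · obtain rfl : k = n := by omega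
      simp [qPoch_zero]
    obtain rfl : n = k + d + 1 := by omega
    have h1 := ih k (d + 1) (by omega)
    have h2 := ih (k + 1) d (by omega)
    rw [gauss_succ_succ, show k + d + 1 - k = d + 1 by omega]
    have e1 := qPoch_self_succ p k
    have e2 := qPoch_self_succ p d
    have e3 := qPoch_self_succ p (k + d + 1)
    rw [e3]
    linear_combination (p ^ (d + 1) * (1 - p ^ (k + 1))) * h1 + (1 - p ^ (d + 1)) * h2
      + (p ^ (d + 1) * gauss p (k + d + 1) k * qPoch p p (d + 1)) * e1
      + (gauss p (k + d + 1) (k + 1) * qPoch p p (k + 1)) * e2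

theorem gauss_eq_div {p : ℂ} (hp : ‖p‖ < 1) (k d : ℕ) :
    gauss p (k + d) k = qPoch p p (k + d) / (qPoch p p k * qPoch p p d) := by
  rw [eq_div_iff (mul_ne_zero (qPoch_self_ne_zero hp k) (qPoch_self_ne_zero hp d)),
    gauss_mul_qPoch]

theorem gauss_symm {p : ℂ} (hp : ‖p‖ < 1) (k d : ℕ) :
    gauss p (k + d) k = gauss p (k + d) d := by
  rw [gauss_eq_div hp, add_comm k d, gauss_eq_div hp, mul_comm (qPoch p p k)]

/-- The reflection k ↦ n - k carries the defining Pascal rule into this one. The reflection comes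
from the quotient formula, which is where `‖p‖ < 1` is needed. -/
theorem gauss_succ_succ' {p : ℂ} (hp : ‖p‖ < 1) (n k : ℕ) :
    gauss p (n + 1) (k + 1) = gauss p n k + p ^ (k + 1) * gauss p n (k + 1) := by
  rcases lt_trichotomy n k with h | rfl | h
  · rw [gauss_of_lt p (by omega), gauss_of_lt p h, gauss_of_lt p (by omega)]; ring
  · rw [gauss_self, gauss_self, gauss_of_lt p (by omega)]; ring
  · obtain ⟨d, rfl⟩ := Nat.exists_eq_add_of_lt h
    have h1 := gauss_symm hp (k + 1) (d + 1)
    rw [show k + 1 + (d + 1) = k + d + 1 + 1 by ring] at h1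
    rw [h1, gauss_succ_succ, show k + d + 1 - d = k + 1 by omega]
    have h2 := gauss_symm hp (k + 1) d
    have h3 := gauss_symm hp k (d + 1)
    rw [show k + 1 + d = k + d + 1 by ring] at h2
    rw [show k + (d + 1) = k + d + 1 by ring] at h3
    rw [h2, h3]; ring

/-- The `q`-Vandermonde convolution. -/
theorem gauss_add (p : ℂ) (m n r : ℕ) :
    gauss p (m + n) r = ∑ u ∈ antidiagonal r,
      p ^ ((n - u.2) * u.1) * gauss p m u.1 * gauss p n u.2 := by
  induction m generalizing r with
  | zero =>
    rcases r with _ | r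
    · simp
    · rw [Finset.Nat.sum_antidiagonal_succ]
      simp
  | succ m ih =>
    rcases r with _ | r
    · simp
    rw [show m + 1 + n = m + n + 1 by ring, gauss_succ_succ, ih, ih,
      Finset.Nat.sum_antidiagonal_succ, Finset.Nat.sum_antidiagonal_succ, Finset.mul_sum]
    simp only [gauss_succ_succ, gauss_zero_right, mul_add, add_mul, Finset.sum_add_distrib]
    rw [← add_assoc, add_comm (∑ _ ∈ _, _), add_right_comm, add_assoc]
    congr 1
    rw [add_comm]
    congr 1
    refine Finset.sum_congr rfl fun u hu => ?_
    have hu' := mem_antidiagonal.1 hu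
    rcases le_or_gt u.1 m with h1 | h1
    · rcases le_or_gt u.2 n with h2 | h2
      · obtain ⟨c, hc⟩ := Nat.exists_eq_add_of_le h1
        obtain ⟨d, hd⟩ := Nat.exists_eq_add_of_le h2
        rw [show m + n - r = (m - u.1) + (n - u.2) by omega]
        ring
      · rw [gauss_of_lt p h2]; ring
    · rw [gauss_of_lt p h1]; ring

theorem gauss_mul_gauss {p : ℂ} (hp : ‖p‖ < 1) (n k l : ℕ) :
    gauss p (l + n) (l + k) * gauss p (l + k) l = gauss p (l + n) l * gauss p n k := by
  rcases lt_or_ge n k with h | h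
  · rw [gauss_of_lt p h, gauss_of_lt p (by omega)]; ring
  · obtain ⟨d, rfl⟩ := Nat.exists_eq_add_of_le h
    have h1 := gauss_eq_div hp (l + k) d
    rw [add_assoc] at h1
    rw [h1, gauss_eq_div hp l k, gauss_eq_div hp l (k + d), gauss_eq_div hp k d]
    have := qPoch_self_ne_zero hp
    field_simp [this]

theorem gauss_mul_gauss' {p : ℂ} (hp : ‖p‖ < 1) (n k t : ℕ) :
    gauss p n (k + t) * gauss p (k + t) t = gauss p n k * gauss p (n - k) t := by
  rcases lt_or_ge n (k + t) with h | h
  · rw [gauss_of_lt p h]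
    rcases lt_or_ge n k with h' | h'
    · rw [gauss_of_lt p h']; ring
    · rw [gauss_of_lt p (show n - k < t by omega)]; ring
  · obtain ⟨d, rfl⟩ := Nat.exists_eq_add_of_le h
    rw [← gauss_symm hp k t, add_assoc, gauss_mul_gauss hp,
      show k + (t + d) - k = t + d by omega]

/-- A form of the `q`-Pfaff-Saalschütz sum. -/
theorem sum_gauss_mul_gauss_mul_gauss {p : ℂ} (hp : ‖p‖ < 1) (M k e : ℕ) :
    ∑ l ∈ Finset.range (min k e + 1),
      p ^ ((k - l) * (e - l)) * gauss p M (e - l) * gauss p M (k - l) * gauss p (2 * M + l) l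
      = gauss p (M + e) k * gauss p (M + k) e := by
  have lhs : ∀ l ∈ Finset.range (min k e + 1),
      p ^ ((k - l) * (e - l)) * gauss p M (e - l) * gauss p M (k - l) * gauss p (2 * M + l) l
      = ∑ u ∈ antidiagonal l, p ^ ((k - l) * (e - l)) * gauss p M (k - l) *
          (p ^ ((M - (e - u.1)) * u.1) * gauss p (M + e) u.1 *
            (gauss p M (e - u.1) * gauss p (e - u.1) u.2)) := by
    intro l hl
    have hl' : l ≤ k ∧ l ≤ e := by simp at hl; omega
    rcases lt_or_ge M (e - l) with h | h
    · rw [gauss_of_lt p h, Finset.sum_eq_zero]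
      · ring
      intro u hu
      have hu' := mem_antidiagonal.1 hu
      rw [gauss_of_lt p (show M < e - u.1 by omega)]; ring
    -- This splitting of the upper index makes Vandermonde produce [M-(e-l); u₂], which merges with
    -- [M; e-l] by `gauss_mul_gauss'`. The index l then survives only through u₁ + u₂.
    · rw [show 2 * M + l = (M + e) + (M - (e - l)) by omega, gauss_add, Finset.mul_sum]
      refine Finset.sum_congr rfl fun u hu => ?_
      have hu' := mem_antidiagonal.1 hu
      have h1 := gauss_mul_gauss' hp M (e - l) u.2
      rw [show e - l + u.2 = e - u.1 by omega] at h1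
      rw [h1]
      rcases lt_or_ge (M - (e - l)) u.2 with h2 | h2
      · rw [gauss_of_lt p h2]; ring
      · rw [show M - (e - l) - u.2 = M - (e - u.1) by omega]; ring
  rw [Finset.sum_congr rfl lhs]
  -- The right side is expanded by Vandermonde twice: [M+k; e] as a sum over l, and, after [M+e; k]
  -- [k; l] = [M+e; l] [M+e-l; k-l], the last binomial as a sum over t. The resulting summand is
  -- that of the left side with (u₁, u₂) = (l, t).
  have rhs : gauss p (M + e) k * gauss p (M + k) e =
      ∑ l ∈ Finset.range (min k e + 1), ∑ t ∈ Finset.range (min k e - l + 1),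
        p ^ ((k - (l + t)) * (e - (l + t))) * gauss p M (k - (l + t)) *
          (p ^ ((M - (e - l)) * l) * gauss p (M + e) l *
            (gauss p M (e - l) * gauss p (e - l) t)) := by
    rw [add_comm M k, gauss_add p k M e, Finset.mul_sum,
        Finset.Nat.sum_antidiagonal_eq_sum_range_succ_mk]
    symm
    have hsub : Finset.range (min k e + 1) ⊆ Finset.range e.succ := by
      intro x hx; simp at hx ⊢; omega
    rw [← Finset.sum_subset hsub]
    · refine Finset.sum_congr rfl fun l hl => ?_
      have hl' : l ≤ k ∧ l ≤ e := by simp at hl; omega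
      have h1 := gauss_mul_gauss hp (M + (e - l)) (k - l) l
      rw [show l + (M + (e - l)) = M + e by omega, show l + (k - l) = k by omega,
        gauss_add p M (e - l) (k - l),
        Finset.Nat.sum_antidiagonal_eq_sum_range_succ_mk,
        ← Finset.sum_range_reflect] at h1
      have h2 : gauss p (M + e) k *
          (p ^ ((M - (e - l)) * l) * gauss p k l * gauss p M (e - l)) =
          (gauss p (M + e) k * gauss p k l) * (p ^ ((M - (e - l)) * l) * gauss p M (e - l)) := by
        ring
      rw [h2, h1, Finset.mul_sum, Finset.sum_mul]
      have hsub2 : Finset.range (min k e - l + 1) ⊆ Finset.range (k - l).succ := by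
        intro x hx; simp at hx ⊢; omega
      rw [← Finset.sum_subset hsub2]
      · refine Finset.sum_congr rfl fun t ht => ?_
        have ht' : t ≤ k - l ∧ t ≤ e - l := by simp at ht; omega
        simp only [Nat.succ_sub_one]
        rw [show k - l - (k - l - t) = t by omega, show k - l - t = k - (l + t) by omega,
          show e - l - t = e - (l + t) by omega]
        ring
      · intro t ht ht'
        simp at ht ht'
        rw [gauss_of_lt p (show e - l < k - l - ((k - l).succ - 1 - t) by omega)]
        ring
    · intro l hl hl'
      simp at hl hl'
      rw [gauss_of_lt p (show k < l by omega)]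
      ring
  rw [rhs, Finset.sum_sigma', Finset.sum_sigma']
  refine Finset.sum_bij' (fun a _ => ⟨a.2.1, a.2.2⟩) (fun a _ => ⟨a.1 + a.2, (a.1, a.2)⟩)
    ?_ ?_ ?_ ?_ ?_
  · rintro ⟨l, u, t⟩ h
    simp at h ⊢
    omega
  · rintro ⟨u, t⟩ h
    simp at h ⊢
    omega
  · rintro ⟨l, u, t⟩ h
    simp at h ⊢
    omega
  · rintro ⟨u, t⟩ h
    simp
  · rintro ⟨l, u, t⟩ h
    simp at h
    obtain rfl := h.2
    simp

/-! ### Coefficients of reciprocal q-Pochhammer symbols -/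

/-- The coefficient of `z ^ r` in `1 / (z; p)_n`. -/
noncomputable def gam (p : ℂ) : ℕ → ℕ → ℂ
  | 0, r => if r = 0 then 1 else 0
  | n + 1, r => gauss p (n + r) r

@[simp] theorem gam_zero_right (p : ℂ) (n : ℕ) : gam p n 0 = 1 := by cases n <;> simp [gam]

theorem gam_succ_succ (p : ℂ) (n r : ℕ) :
    gam p (n + 1) (r + 1) = p ^ n * gam p (n + 1) r + gam p n (r + 1) := by
  cases n with
  | zero => simp [gam]
  | succ n =>
    simp only [gam]
    rw [show n + 1 + (r + 1) = n + 1 + r + 1 by ring, gauss_succ_succ, Nat.add_sub_cancel]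
    congr 2
    ring

theorem gam_succ_succ' {p : ℂ} (hp : ‖p‖ < 1) (n r : ℕ) :
    gam p (n + 1) (r + 1) = gam p (n + 1) r + p ^ (r + 1) * gam p n (r + 1) := by
  cases n with
  | zero => simp [gam]
  | succ n =>
    simp only [gam]
    rw [show n + 1 + (r + 1) = n + 1 + r + 1 by ring, gauss_succ_succ' hp]
    congr 3
    ring

/-- `gam`, extended by zero to negative second argument. -/
noncomputable def gamz (p : ℂ) (n : ℕ) (r : ℤ) : ℂ := if 0 ≤ r then gam p n r.toNat else 0

theorem gamz_natCast (p : ℂ) (n r : ℕ) : gamz p n r = gam p n r := by simp [gamz]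

theorem gamz_of_neg (p : ℂ) (n : ℕ) {r : ℤ} (h : r < 0) : gamz p n r = 0 := by
  simp [gamz, not_le.2 h]

/-- Multiplying 1/(z; p)_(n+1) by 1 - z leaves 1/(zp; p)_n, whose coefficients are those of 1/(z;
p)_n scaled by p^r. -/
theorem gamz_sub_gamz {p : ℂ} (hp : ‖p‖ < 1) (n r : ℕ) :
    gamz p (n + 1) r - gamz p (n + 1) ((r : ℤ) - 1) = p ^ r * gamz p n r := by
  cases r with
  | zero =>
    rw [gamz_of_neg p _ (by simp : ((0 : ℕ) : ℤ) - 1 < 0), gamz_natCast, gamz_natCast]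
    simp
  | succ r =>
    rw [show ((r + 1 : ℕ) : ℤ) - 1 = (r : ℕ) by push_cast; ring]
    simp only [gamz_natCast]
    rw [gam_succ_succ' hp]; ring

/-- The same with (1 - z)(1 - pz) cleared from 1/(z; p)_(n+2). This operator is the shape of every
recursion in M below. -/
theorem gamz_second_difference {p : ℂ} (hp : ‖p‖ < 1) (n r : ℕ) :
    gamz p (n + 2) r - (1 + p) * gamz p (n + 2) ((r : ℤ) - 1) + p * gamz p (n + 2) ((r : ℤ) - 2)
      = p ^ (2 * r) * gamz p n r := by
  have h1 := gamz_sub_gamz hp (n + 1) r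
  have h2 := gamz_sub_gamz hp n r
  cases r with
  | zero =>
    rw [gamz_of_neg p _ (by simp : ((0 : ℕ) : ℤ) - 2 < 0)]
    rw [gamz_of_neg p _ (by simp : ((0 : ℕ) : ℤ) - 1 < 0)] at *
    simp only [gamz_natCast, gam_zero_right]
    simp
  | succ r =>
    have h3 := gamz_sub_gamz hp (n + 1) r
    rw [show ((r + 1 : ℕ) : ℤ) - 1 = (r : ℕ) by push_cast; ring] at *
    rw [show ((r + 1 : ℕ) : ℤ) - 2 = (r : ℤ) - 1 by push_cast; ring]
    linear_combination h1 - p * h3 + p ^ (r + 1) * h2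

/-! ### Generating functions, over ℂ and over Laurent polynomials -/

section Series

variable {B : Type*} [CommRing B]

/-- The polynomial `(-c X; p)_n`. -/
noncomputable def eSer (f : ℂ →+* B) (p c : ℂ) (n : ℕ) : PowerSeries B :=
  PowerSeries.mk fun k => f (c ^ k * p ^ (k.choose 2) * gauss p n k)

/-- The series `1 / (y X; p)_n`. -/
noncomputable def gSer (f : ℂ →+* B) (y : B) (p : ℂ) (n : ℕ) : PowerSeries B :=
  PowerSeries.mk fun k => f (gam p n k) * y ^ k

theorem eSer_zero (f : ℂ →+* B) (p c : ℂ) : eSer f p c 0 = 1 := by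
  ext k
  cases k <;> simp [eSer, PowerSeries.coeff_one]

theorem eSer_succ (f : ℂ →+* B) (p c : ℂ) (n : ℕ) :
    eSer f p c (n + 1) = eSer f p c n * (1 + PowerSeries.C (f (c * p ^ n)) * PowerSeries.X) := by
  ext k
  rw [mul_add, mul_one, map_add, mul_comm (PowerSeries.C _), ← mul_assoc,
    PowerSeries.coeff_mul_C]
  cases k with
  | zero => simp [eSer]
  | succ k =>
    rw [PowerSeries.coeff_succ_mul_X]
    simp only [eSer, PowerSeries.coeff_mk]
    rw [← map_mul, ← map_add, gauss_succ_succ]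
    congr 1
    rcases le_or_gt k n with h | h
    · obtain ⟨d, rfl⟩ := Nat.exists_eq_add_of_le h
      rw [Nat.choose_succ_left _ _ (by norm_num)]
      simp only [Nat.add_sub_cancel_left, Nat.choose_one_right, Nat.add_one_sub_one]
      ring
    · rw [gauss_of_lt p h]; ring

theorem gSer_zero (f : ℂ →+* B) (y : B) (p : ℂ) : gSer f y p 0 = 1 := by
  ext k
  cases k <;> simp [gSer, gam, PowerSeries.coeff_one]

theorem gSer_succ (f : ℂ →+* B) (y : B) (p : ℂ) (n : ℕ) :
    gSer f y p (n + 1) * (1 - PowerSeries.C (f (p ^ n)) * (PowerSeries.X * PowerSeries.C y))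
      = gSer f y p n := by
  ext k
  rw [mul_sub, mul_one, map_sub, show ∀ F : PowerSeries B, F * (PowerSeries.C (f (p ^ n)) *
    (PowerSeries.X * PowerSeries.C y)) = F * PowerSeries.X * PowerSeries.C (f (p ^ n) * y) by
      intro F; rw [map_mul]; ring, PowerSeries.coeff_mul_C]
  cases k with
  | zero => simp [gSer]
  | succ k =>
    rw [PowerSeries.coeff_succ_mul_X]
    simp only [gSer, PowerSeries.coeff_mk]
    rw [gam_succ_succ, map_add, map_mul]
    ring

end Series

/-! ### Extracting coefficients in z and x -/

/-- Formal power series in `z` over the Laurent polynomials in `x`. -/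
abbrev Ser := PowerSeries (LaurentPolynomial ℂ)

/-- The constant series. -/
noncomputable def scal : ℂ →+* Ser := (PowerSeries.C).comp LaurentPolynomial.C

/-- The variable `x`. -/
noncomputable def xv : Ser := PowerSeries.C (LaurentPolynomial.T 1)

/-- The inverse of the variable `x`. -/
noncomputable def xi : Ser := PowerSeries.C (LaurentPolynomial.T (-1))

/-- The variable `z`. -/
noncomputable def zv : Ser := PowerSeries.X

theorem xv_mul_xi : xv * xi = 1 := by
  rw [xv, xi, ← map_mul, ← LaurentPolynomial.T_add]; simp

/-- The coefficient of `z ^ L * x ^ (-a)`. -/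
noncomputable def zxCoeff (L a : ℤ) (F : Ser) : ℂ :=
  if 0 ≤ L then (PowerSeries.coeff L.toNat F).coeff (-a) else 0

theorem zxCoeff_add (L a : ℤ) (F G : Ser) :
    zxCoeff L a (F + G) = zxCoeff L a F + zxCoeff L a G := by
  unfold zxCoeff; split_ifs <;> simp

theorem zxCoeff_sub (L a : ℤ) (F G : Ser) :
    zxCoeff L a (F - G) = zxCoeff L a F - zxCoeff L a G := by
  unfold zxCoeff; split_ifs <;> simp

theorem laurent_coeff_mul_T (F : LaurentPolynomial ℂ) (n a : ℤ) :
    (F * LaurentPolynomial.T n).coeff a = F.coeff (a - n) := by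
  rw [LaurentPolynomial.T, AddMonoidAlgebra.coeff_mul_single_eq_coeff_mul (a - n), mul_one]
  intro m _
  omega

theorem zxCoeff_scal_mul (L a : ℤ) (c : ℂ) (F : Ser) :
    zxCoeff L a (scal c * F) = c * zxCoeff L a F := by
  unfold zxCoeff
  split_ifs
  · rw [scal, RingHom.comp_apply, PowerSeries.coeff_C_mul, ← LaurentPolynomial.smul_eq_C_mul]
    simp
  · simp

theorem zxCoeff_xv_mul (L a : ℤ) (F : Ser) :
    zxCoeff L a (xv * F) = zxCoeff L (a + 1) F := by
  unfold zxCoeff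
  split_ifs
  · rw [xv, PowerSeries.coeff_C_mul, mul_comm, laurent_coeff_mul_T]
    congr 1; ring
  · rfl

theorem zxCoeff_xi_mul (L a : ℤ) (F : Ser) :
    zxCoeff L a (xi * F) = zxCoeff L (a - 1) F := by
  unfold zxCoeff
  split_ifs
  · rw [xi, PowerSeries.coeff_C_mul, mul_comm, laurent_coeff_mul_T]
    congr 1; ring
  · rfl

theorem zxCoeff_zv_mul (L a : ℤ) (F : Ser) :
    zxCoeff L a (zv * F) = zxCoeff (L - 1) a F := by
  unfold zxCoeff zv
  rcases lt_trichotomy L 0 with h | rfl | h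
  · rw [if_neg (by omega), if_neg (by omega)]
  · simp
  · obtain ⟨n, rfl⟩ : ∃ n : ℕ, L = n + 1 := ⟨(L - 1).toNat, by omega⟩
    rw [if_pos (by omega), if_pos (by omega), show ((n : ℤ) + 1).toNat = n + 1 by omega,
      PowerSeries.coeff_succ_X_mul, show ((n : ℤ) + 1 - 1).toNat = n by omega]

/-! ### Refined q-trinomial coefficients and their recursions -/

/-- The polynomial `(-z σ; σ²)_n`. -/
noncomputable def eS (σ : ℂ) (n : ℕ) : Ser := eSer LaurentPolynomial.C (σ ^ 2) σ n

/-- The series `1 / (z x; σ²)_n`. -/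
noncomputable def gX (σ : ℂ) (n : ℕ) : Ser :=
  gSer LaurentPolynomial.C (LaurentPolynomial.T 1) (σ ^ 2) n

/-- The series `1 / (z / x; σ²)_n`. -/
noncomputable def gXi (σ : ℂ) (n : ℕ) : Ser :=
  gSer LaurentPolynomial.C (LaurentPolynomial.T (-1)) (σ ^ 2) n

theorem eS_succ (σ : ℂ) (n : ℕ) :
    eS σ (n + 1) = eS σ n * (1 + scal σ ^ (2 * n + 1) * zv) := by
  rw [eS, eSer_succ, ← map_pow, show σ * (σ ^ 2) ^ n = σ ^ (2 * n + 1) by ring]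
  rfl

theorem gX_succ (σ : ℂ) (n : ℕ) :
    gX σ (n + 1) * (1 - scal σ ^ (2 * n) * (zv * xv)) = gX σ n := by
  rw [gX, gX, ← gSer_succ _ _ _ n, ← map_pow, ← pow_mul]
  rfl

theorem gXi_succ (σ : ℂ) (n : ℕ) :
    gXi σ (n + 1) * (1 - scal σ ^ (2 * n) * (zv * xi)) = gXi σ n := by
  rw [gXi, gXi, ← gSer_succ _ _ _ n, ← map_pow, ← pow_mul]
  rfl

/-- The refined `q`-trinomial coefficient, with `q = σ²`. -/
noncomputable def tau (σ : ℂ) (L M a : ℤ) (b : ℕ) : ℂ :=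
  if (b : ℤ) ≤ M then
    zxCoeff L a (eS σ M.toNat * gX σ (M.toNat + b + 1) * gXi σ (M.toNat - b + 1))
  else 0

theorem tau_of_lt (σ : ℂ) (L a : ℤ) {M : ℤ} {b : ℕ} (h : M < b) : tau σ L M a b = 0 :=
  if_neg (by omega)

theorem tau_of_neg (σ : ℂ) {L : ℤ} (M a : ℤ) (b : ℕ) (h : L < 0) : tau σ L M a b = 0 := by
  unfold tau zxCoeff
  split_ifs <;> first | rfl | omega

theorem tau_add (σ : ℂ) (L a : ℤ) (b r : ℕ) {M : ℤ} (h : M = b + r) :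
    tau σ L M a b = zxCoeff L a (eS σ (b + r) * gX σ (2 * b + r + 1) * gXi σ (r + 1)) := by
  subst h
  rw [tau, if_pos (by omega), show ((b : ℤ) + r).toNat = b + r by omega,
    show b + r + b + 1 = 2 * b + r + 1 by ring, show b + r - b + 1 = r + 1 by omega]

/-- Only non-negative powers of `x` occur in `(-z σ; σ²)_m / (z x; σ²)_n`. -/
theorem zxCoeff_eS_mul_gX (σ : ℂ) (L : ℤ) {a : ℤ} (ha : 0 < a) (m n : ℕ) :
    zxCoeff L a (eS σ m * gX σ n) = 0 := by
  unfold zxCoeff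
  split_ifs
  · rw [PowerSeries.coeff_mul, AddMonoidAlgebra.coeff_sum, Finsupp.finsetSum_apply]
    refine Finset.sum_eq_zero fun u _ => ?_
    simp only [eS, gX, eSer, gSer, PowerSeries.coeff_mk]
    rw [LaurentPolynomial.T_pow, ← mul_assoc, ← map_mul, laurent_coeff_mul_T,
      LaurentPolynomial.C_apply, if_neg (by omega)]
  · rfl

/-- Raising M and b together leaves the denominator in z/x unchanged, adds two factors to the
denominator in zx and one to the numerator. Clearing the two new denominators gives the relation. -/
theorem tau_succ_succ (σ : ℂ) (L a : ℤ) (M b : ℕ) :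
    tau σ L (M + 1 : ℕ) a (b + 1)
      - (σ ^ (2 * (M + b + 1)) + σ ^ (2 * (M + b + 2))) * tau σ (L - 1) (M + 1 : ℕ) (a + 1) (b + 1)
      + σ ^ (2 * (2 * M + 2 * b + 3)) * tau σ (L - 2) (M + 1 : ℕ) (a + 2) (b + 1)
      = tau σ L M a b + σ ^ (2 * M + 1) * tau σ (L - 1) M a b := by
  rcases lt_or_ge M b with h | h
  · simp only [tau_of_lt σ _ _ (show (M : ℤ) < b by omega),
      tau_of_lt σ _ _ (show ((M + 1 : ℕ) : ℤ) < (b + 1 : ℕ) by omega)]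
    ring
  obtain ⟨r, rfl⟩ := Nat.exists_eq_add_of_le h
  simp only [tau_add σ _ _ b r (show ((b + r : ℕ) : ℤ) = b + r by push_cast; ring),
    tau_add σ _ _ (b + 1) r (show ((b + r + 1 : ℕ) : ℤ) = (b + 1 : ℕ) + r by push_cast; ring)]
  rw [show b + 1 + r = b + r + 1 by ring, show 2 * (b + 1) + r + 1 = 2 * b + r + 3 by ring]
  set F := eS σ (b + r + 1) * gX σ (2 * b + r + 3) * gXi σ (r + 1) with hF
  set G := eS σ (b + r) * gX σ (2 * b + r + 1) * gXi σ (r + 1) with hG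
  -- A ring identity between generating functions. Taking `zxCoeff` then turns multiplication by z
  -- and x into shifts of L and a.
  have key : F - scal (σ ^ (2 * (b + r + b + 1)) + σ ^ (2 * (b + r + b + 2))) * (zv * (xv * F))
      + scal (σ ^ (2 * (2 * (b + r) + 2 * b + 3))) * (zv * (zv * (xv * (xv * F))))
      = G + scal (σ ^ (2 * (b + r) + 1)) * (zv * G) := by
    rw [hF, hG, eS_succ, ← gX_succ σ (2 * b + r + 1), ← gX_succ σ (2 * b + r + 1 + 1)]
    simp only [map_add, map_pow]
    ring
  have := congrArg (zxCoeff L a) key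
  simp only [zxCoeff_add, zxCoeff_sub, zxCoeff_scal_mul, zxCoeff_zv_mul, zxCoeff_xv_mul,
    sub_sub, add_assoc, one_add_one_eq_two] at this ⊢
  linear_combination this

/-- With b = 0, raising M adds one factor to each denominator. In the product of the two, x · (1/x)
= 1 makes the quadratic term free of x. -/
theorem tau_succ_zero (σ : ℂ) (L a : ℤ) (M : ℕ) :
    tau σ L (M + 1 : ℕ) a 0
      - σ ^ (2 * (M + 1)) * (tau σ (L - 1) (M + 1 : ℕ) (a + 1) 0
        + tau σ (L - 1) (M + 1 : ℕ) (a - 1) 0)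
      + σ ^ (4 * (M + 1)) * tau σ (L - 2) (M + 1 : ℕ) a 0
      = tau σ L M a 0 + σ ^ (2 * M + 1) * tau σ (L - 1) M a 0 := by
  simp only [tau_add σ _ _ 0 M (show ((M : ℕ) : ℤ) = (0 : ℕ) + M by push_cast; ring),
    tau_add σ _ _ 0 (M + 1) (show ((M + 1 : ℕ) : ℤ) = (0 : ℕ) + (M + 1 : ℕ) by push_cast; ring)]
  rw [show 0 + (M + 1) = M + 1 by ring, show 2 * 0 + M + 1 = M + 1 by ring,
    show 0 + M = M by ring]
  set F := eS σ (M + 1) * gX σ (M + 1 + 1) * gXi σ (M + 1 + 1) with hF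
  set G := eS σ M * gX σ (M + 1) * gXi σ (M + 1) with hG
  have key : F - scal (σ ^ (2 * (M + 1))) * (zv * (xv * F) + zv * (xi * F))
      + scal (σ ^ (4 * (M + 1))) * (zv * (zv * F))
      = G + scal (σ ^ (2 * M + 1)) * (zv * G) := by
    rw [hF, hG, eS_succ, ← gX_succ σ (M + 1), ← gXi_succ σ (M + 1)]
    simp only [map_pow]
    linear_combination (-(scal σ ^ (4 * (M + 1)) * zv ^ 2 * (eS σ M *
      (1 + scal σ ^ (2 * M + 1) * zv) * gX σ (M + 1 + 1) * gXi σ (M + 1 + 1)))) * xv_mul_xi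
  have := congrArg (zxCoeff L a) key
  simp only [zxCoeff_add, zxCoeff_sub, zxCoeff_scal_mul, zxCoeff_zv_mul, zxCoeff_xv_mul,
    zxCoeff_xi_mul, sub_sub, one_add_one_eq_two] at this ⊢
  linear_combination this

/-- The case m + 1 of `tau_zero_second_difference` for generating functions, divided by the common
product; S stands for σ and w for σ^(2m). It holds only modulo xy = 1, and the long coefficient is
the cofactor of that relation. -/
theorem second_difference_identity_zero {R : Type*} [CommRing R] (S w z x y : R)
    (h : x * y = 1) :
    (1 + S * w * z) * (1 + S ^ 3 * w * z)
      - (1 + S ^ 2) * ((1 + S * w * z) * (1 - S ^ 4 * w * z * x) * (1 - S ^ 4 * w * z * y))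
      + S ^ 2 * ((1 - S ^ 4 * w * z * x) * (1 - S ^ 2 * w * z * x) * (1 - S ^ 4 * w * z * y)
        * (1 - S ^ 2 * w * z * y))
      - S ^ 4 * w * z * (x + y) * ((1 + S * w * z) * (1 + S ^ 3 * w * z)
        - (1 + S * w * z) * (1 - S ^ 4 * w * z * x) * (1 - S ^ 4 * w * z * y))
      + S ^ 8 * w ^ 2 * z ^ 2 * ((1 + S * w * z) * (1 + S ^ 3 * w * z))
    = S ^ 3 * w * z * ((1 + S * w * z) * (1 - S ^ 4 * w * z * x) * (1 - S ^ 4 * w * z * y)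
        - (1 - S ^ 4 * w * z * x) * (1 - S ^ 2 * w * z * x) * (1 - S ^ 4 * w * z * y)
          * (1 - S ^ 2 * w * z * y))
      + S ^ 6 * w ^ 2 * z ^ 2 *
        ((1 + S * w * z) * (1 - S ^ 4 * w * z * x) * (1 - S ^ 4 * w * z * y)) := by
  linear_combination ((S ^ 6 * w ^ 2 * z ^ 2) + (S ^ 7 * w ^ 3 * z ^ 3) + (-1 * S ^ 8 * w ^ 2
      * z ^ 2) + (-1 * S ^
    9 * w ^ 3 * z ^ 3) + (-1 * S ^ 10 * w ^ 3 * z ^ 3 * y) + (-1 * S ^ 10 * w ^ 3 * z ^ 3 * x) +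
    (-1 * S ^ 11 * w ^ 3 * z ^ 3) + (-1 * S ^ 11 * w ^ 4 * z ^ 4 * y) + (-1 * S ^ 11 * w ^ 4 * z
    ^ 4 * x) + (-1 * S ^ 12 * w ^ 4 * z ^ 4) + (S ^ 14 * w ^ 4 * z ^ 4 * x * y) + (S ^ 15 * w ^
    5 * z ^ 5 * x * y)) * h

/-- The analogue for `tau_second_difference` at m = b + r + 1, with S, w, v standing for σ, σ^(2r),
σ^(2b). -/
theorem second_difference_identity {R : Type*} [CommRing R] (S w v z x y : R)
    (h : x * y = 1) :
    S * v * (x * ((1 + S * v * w * z) * (1 + S ^ 3 * v * w * z) * (1 - S ^ 4 * w * z * y)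
          - (1 + S ^ 2) * ((1 + S * v * w * z) * (1 - S ^ 6 * v ^ 2 * w * z * x)
            * (1 - S ^ 4 * w * z * y) * (1 - S ^ 2 * w * z * y))
          + S ^ 2 * ((1 - S ^ 6 * v ^ 2 * w * z * x) * (1 - S ^ 4 * v ^ 2 * w * z * x)
            * (1 - S ^ 4 * w * z * y) * (1 - S ^ 2 * w * z * y) * (1 - w * z * y)))
        - (v + v * S ^ 2) * (S ^ 4 * v * w) * z * x ^ 2 *
          ((1 + S * v * w * z) * (1 + S ^ 3 * v * w * z) * (1 - S ^ 4 * w * z * y)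
            - (1 + S * v * w * z) * (1 - S ^ 6 * v ^ 2 * w * z * x)
              * (1 - S ^ 4 * w * z * y) * (1 - S ^ 2 * w * z * y))
        + S ^ 2 * v ^ 2 * (S ^ 4 * v * w) ^ 2 * z ^ 2 * x ^ 3 *
          ((1 + S * v * w * z) * (1 + S ^ 3 * v * w * z) * (1 - S ^ 4 * w * z * y)))
    = S ^ 3 * v * w * z * ((1 + S * v * w * z) * (1 - S ^ 6 * v ^ 2 * w * z * x)
            * (1 - S ^ 4 * v ^ 2 * w * z * x) * (1 - S ^ 4 * w * z * y)
          - (1 - S ^ 6 * v ^ 2 * w * z * x) * (1 - S ^ 4 * v ^ 2 * w * z * x)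
            * (1 - S ^ 2 * v ^ 2 * w * z * x) * (1 - S ^ 4 * w * z * y) * (1 - S ^ 2 * w * z * y))
      + S ^ 6 * v ^ 2 * w ^ 2 * z ^ 2 * ((1 + S * v * w * z) * (1 - S ^ 6 * v ^ 2 * w * z * x)
            * (1 - S ^ 4 * v ^ 2 * w * z * x) * (1 - S ^ 4 * w * z * y)) := by
  linear_combination ((S ^ 4 * w ^ 2 * v ^ 2 * z ^ 2) + (S ^ 5 * w ^ 2 * v * z ^ 2 * y) + (S ^
      6 * w ^ 2 * v ^ 2 *
    z ^ 2) + (S ^ 7 * w ^ 3 * v ^ 3 * z ^ 3) + (-1 * S ^ 8 * w ^ 3 * v ^ 2 * z ^ 3 * y) + (-1 *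
    S ^ 8 * w ^ 3 * v ^ 4 * z ^ 3 * x) + (-1 * S ^ 9 * w ^ 3 * v * z ^ 3 * y ^ 2) + (-1 * S ^ 9
    * w ^ 3 * v ^ 3 * z ^ 3 * x * y) + (-1 * S ^ 10 * w ^ 3 * v ^ 2 * z ^ 3 * y) + (-2 * S ^ 10
    * w ^ 3 * v ^ 4 * z ^ 3 * x) + (-1 * S ^ 11 * w ^ 3 * v ^ 3 * z ^ 3 * x * y) + (-1 * S ^ 11
    * w ^ 4 * v ^ 3 * z ^ 4 * y) + (-1 * S ^ 11 * w ^ 4 * v ^ 5 * z ^ 4 * x) + (-1 * S ^ 12 * w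
    ^ 3 * v ^ 4 * z ^ 3 * x) + (S ^ 12 * w ^ 4 * v ^ 4 * z ^ 4 * x * y) + (S ^ 13 * w ^ 4 * v ^
    3 * z ^ 4 * x * y ^ 2) + (-1 * S ^ 13 * w ^ 4 * v ^ 5 * z ^ 4 * x) + (2 * S ^ 14 * w ^ 4 * v
    ^ 4 * z ^ 4 * x * y) + (S ^ 14 * w ^ 4 * v ^ 6 * z ^ 4 * x ^ 2) + (S ^ 15 * w ^ 4 * v ^ 3 *
    z ^ 4 * x * y ^ 2) + (S ^ 15 * w ^ 4 * v ^ 5 * z ^ 4 * x ^ 2 * y) + (S ^ 15 * w ^ 5 * v ^ 5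
    * z ^ 5 * x * y) + (S ^ 16 * w ^ 4 * v ^ 4 * z ^ 4 * x * y) + (S ^ 16 * w ^ 4 * v ^ 6 * z ^
    4 * x ^ 2) + (S ^ 17 * w ^ 5 * v ^ 5 * z ^ 5 * x * y) + (S ^ 17 * w ^ 5 * v ^ 7 * z ^ 5 * x
    ^ 2) + (-1 * S ^ 18 * w ^ 5 * v ^ 6 * z ^ 5 * x ^ 2 * y) + (-1 * S ^ 19 * w ^ 5 * v ^ 5 * z
    ^ 5 * x ^ 2 * y ^ 2) + (-1 * S ^ 20 * w ^ 5 * v ^ 6 * z ^ 5 * x ^ 2 * y) + (-1 * S ^ 21 * w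
    ^ 6 * v ^ 7 * z ^ 6 * x ^ 2 * y)) * h

theorem zxCoeff_one (L a : ℤ) : zxCoeff L a 1 = if L = 0 ∧ a = 0 then 1 else 0 := by
  unfold zxCoeff
  rcases lt_trichotomy L 0 with h | rfl | h
  · rw [if_neg (by omega), if_neg (by omega)]
  · rw [if_pos le_rfl, Int.toNat_zero, PowerSeries.coeff_zero_one, ← LaurentPolynomial.T_zero,
      LaurentPolynomial.T_apply]
    simp [eq_comm]
  · rw [if_pos h.le, PowerSeries.coeff_one, if_neg (by omega), if_neg (by omega)]
    simp

/-- The recursion in `M` satisfied by the refined `q`-trinomial coefficients with `b = 0`. -/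
theorem tau_zero_second_difference (σ : ℂ) (L a : ℤ) (m : ℕ) :
    tau σ L (m + 1 : ℕ) a 0 - (1 + σ ^ 2) * tau σ L m a 0 + σ ^ 2 * tau σ L ((m : ℤ) - 1) a 0
      - σ ^ (2 * (m + 1)) * (tau σ (L - 1) (m + 1 : ℕ) (a + 1) 0 - tau σ (L - 1) m (a + 1) 0
        + (tau σ (L - 1) (m + 1 : ℕ) (a - 1) 0 - tau σ (L - 1) m (a - 1) 0))
      + σ ^ (4 * (m + 1)) * tau σ (L - 2) (m + 1 : ℕ) a 0
      = σ ^ (2 * m + 1) * (tau σ (L - 1) m a 0 - tau σ (L - 1) ((m : ℤ) - 1) a 0)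
        + σ ^ (4 * m + 2) * tau σ (L - 2) m a 0
        - if m = 0 then σ ^ 2 * (if L = 0 ∧ a = 0 then 1 else 0) else 0 := by
  rcases m with _ | m
  · have e1 : ∀ L a : ℤ, tau σ L (0 + 1 : ℕ) a 0 = zxCoeff L a (eS σ 1 * gX σ 2 * gXi σ 2) :=
      fun L a => tau_add σ L a 0 1 (by simp)
    have e2 : ∀ L a : ℤ, tau σ L (0 : ℕ) a 0 = zxCoeff L a (eS σ 0 * gX σ 1 * gXi σ 1) :=
      fun L a => tau_add σ L a 0 0 (by simp)
    have e3 : ∀ L a : ℤ, tau σ L (((0 : ℕ) : ℤ) - 1) a 0 = 0 :=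
      fun L a => tau_of_lt σ L a (by simp)
    simp only [e1, e2, e3]
    rw [if_pos trivial, ← zxCoeff_one]
    set F := eS σ 1 * gX σ 2 * gXi σ 2 with hF
    set G := eS σ 0 * gX σ 1 * gXi σ 1 with hG
    have key : F - scal (1 + σ ^ 2) * G
        - scal (σ ^ 2) * (zv * (xv * F) - zv * (xv * G) + (zv * (xi * F) - zv * (xi * G)))
        + scal (σ ^ 4) * (zv * (zv * F))
        = scal σ * (zv * G) + scal (σ ^ 2) * (zv * (zv * G)) - scal (σ ^ 2) * 1 := by
      -- At m = 0 the lower neighbour M = -1 is zero by convention, and G is the reciprocal of (1 -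
      -- zx)(1 - z/x). Clearing it leaves the constant -σ², which is seen only at L = a = 0.
      have h1 : G * (1 - zv * xv) * (1 - zv * xi) = 1 := by
        have h2 := gX_succ σ 0
        have h3 := gXi_succ σ 0
        simp only [mul_zero, pow_zero, one_mul, zero_add] at h2 h3
        rw [hG, show eS σ 0 = 1 from eSer_zero _ _ _]
        rw [show gX σ 0 = 1 from gSer_zero _ _ _] at h2
        rw [show gXi σ 0 = 1 from gSer_zero _ _ _] at h3
        linear_combination (gXi σ 1 * (1 - zv * xi)) * h2 + h3
      have h4 : F * (1 - scal σ ^ 2 * (zv * xv)) * (1 - scal σ ^ 2 * (zv * xi))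
          = (1 + scal σ * zv) * G := by
        have h2 := gX_succ σ 1
        have h3 := gXi_succ σ 1
        have h5 := eS_succ σ 0
        simp only [mul_one, mul_zero, zero_add, pow_one, one_add_one_eq_two] at h2 h3 h5
        rw [hG, hF, ← h2, ← h3, h5]
        ring
      simp only [map_add, map_pow, map_one]
      linear_combination h4 - scal σ ^ 2 * h1
        + (scal σ ^ 2 * zv ^ 2 * G - scal σ ^ 4 * zv ^ 2 * F) * xv_mul_xi
    have := congrArg (zxCoeff L a) key
    simp only [zxCoeff_add, zxCoeff_sub, zxCoeff_scal_mul, zxCoeff_zv_mul, zxCoeff_xv_mul,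
      zxCoeff_xi_mul, sub_sub, one_add_one_eq_two] at this ⊢
    linear_combination this
  · have e1 : ∀ L a : ℤ, tau σ L (m + 1 + 1 : ℕ) a 0
        = zxCoeff L a (eS σ (m + 2) * gX σ (m + 3) * gXi σ (m + 3)) := fun L a => by
      rw [tau_add σ L a 0 (m + 2) (by push_cast; ring)]
      congr 4 <;> ring
    have e2 : ∀ L a : ℤ, tau σ L (m + 1 : ℕ) a 0
        = zxCoeff L a (eS σ (m + 1) * gX σ (m + 2) * gXi σ (m + 2)) := fun L a => by
      rw [tau_add σ L a 0 (m + 1) (by push_cast; ring)]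
      congr 4 <;> ring
    have e3 : ∀ L a : ℤ, tau σ L (((m + 1 : ℕ) : ℤ) - 1) a 0
        = zxCoeff L a (eS σ m * gX σ (m + 1) * gXi σ (m + 1)) := fun L a => by
      rw [tau_add σ L a 0 m (by push_cast; ring)]
      congr 4 <;> ring
    simp only [e1, e2, e3]
    rw [if_neg (by omega)]
    set F := eS σ (m + 2) * gX σ (m + 3) * gXi σ (m + 3) with hF
    set G := eS σ (m + 1) * gX σ (m + 2) * gXi σ (m + 2) with hG
    set H := eS σ m * gX σ (m + 1) * gXi σ (m + 1) with hH
    have key : F - scal (1 + σ ^ 2) * G + scal (σ ^ 2) * H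
        - scal (σ ^ (2 * (m + 1 + 1))) *
          (zv * (xv * F) - zv * (xv * G) + (zv * (xi * F) - zv * (xi * G)))
        + scal (σ ^ (4 * (m + 1 + 1))) * (zv * (zv * F))
        = scal (σ ^ (2 * (m + 1) + 1)) * (zv * G - zv * H)
          + scal (σ ^ (4 * (m + 1) + 2)) * (zv * (zv * G)) := by
      have h := second_difference_identity_zero (scal σ) (scal σ ^ (2 * m)) zv xv xi xv_mul_xi
      rw [hF, hG, hH, eS_succ σ (m + 1), eS_succ σ m, ← gX_succ σ (m + 1), ← gX_succ σ (m + 2),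
        ← gXi_succ σ (m + 1), ← gXi_succ σ (m + 2)]
      simp only [map_add, map_pow, map_one]
      linear_combination (eS σ m * gX σ (m + 3) * gXi σ (m + 3)) * h
    have := congrArg (zxCoeff L a) key
    simp only [zxCoeff_add, zxCoeff_sub, zxCoeff_scal_mul, zxCoeff_zv_mul, zxCoeff_xv_mul,
      zxCoeff_xi_mul, sub_sub, one_add_one_eq_two] at this ⊢
    linear_combination this

/-- The recursion that the right side of `tauSum_eq` must satisfy to match `tauSum_succ_right`. The
prefactor is σ^((b+1)² - b²), and a + 1 occurs because the transformation shifts a by b. -/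
theorem tau_second_difference (σ : ℂ) (L : ℤ) {a : ℤ} (ha : 0 ≤ a) (m b : ℕ) :
    σ ^ (2 * b + 1) * (tau σ L (m + 1 : ℕ) (a + 1) (b + 1)
      - (1 + σ ^ 2) * tau σ L m (a + 1) (b + 1) + σ ^ 2 * tau σ L ((m : ℤ) - 1) (a + 1) (b + 1)
      - (σ ^ (2 * b) + σ ^ (2 * (b + 1))) * σ ^ (2 * (m + 1)) *
        (tau σ (L - 1) (m + 1 : ℕ) (a + 2) (b + 1) - tau σ (L - 1) m (a + 2) (b + 1))
      + σ ^ (2 * (2 * b + 1 + 2 * (m + 1))) * tau σ (L - 2) (m + 1 : ℕ) (a + 3) (b + 1))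
      = σ ^ (2 * m + 1) * (tau σ (L - 1) m a b - tau σ (L - 1) ((m : ℤ) - 1) a b)
        + σ ^ (4 * m + 2) * tau σ (L - 2) m a b := by
  rcases lt_trichotomy m b with h | rfl | h
  · simp only [tau_of_lt σ _ _ (show (m : ℤ) < b by omega),
      tau_of_lt σ _ _ (show (m : ℤ) - 1 < b by omega),
      tau_of_lt σ _ _ (show (m : ℤ) < (b + 1 : ℕ) by omega),
      tau_of_lt σ _ _ (show (m : ℤ) - 1 < (b + 1 : ℕ) by omega),
      tau_of_lt σ _ _ (show ((m + 1 : ℕ) : ℤ) < (b + 1 : ℕ) by omega)]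
    ring
  -- On the boundary m = b the convention `tau` = 0 for M < b takes effect. The identity of series
  -- acquires extra terms without negative powers of x, which do not contribute at x^(-(a+1))
  -- because a ≥ 0.
  · have e1 : ∀ L a : ℤ, tau σ L (m + 1 : ℕ) a (m + 1)
        = zxCoeff L a (eS σ (m + 1) * gX σ (2 * m + 3) * gXi σ 1) := fun L a => by
      rw [tau_add σ L a (m + 1) 0 (by simp)]
      congr 4
    have e2 : ∀ L a : ℤ, tau σ L m a m
        = zxCoeff L a (eS σ m * gX σ (2 * m + 1) * gXi σ 1) := fun L a => by
      rw [tau_add σ L a m 0 (by simp)]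
      congr 4
    simp only [e1, e2, tau_of_lt σ _ _ (show (m : ℤ) - 1 < m by omega),
      tau_of_lt σ _ _ (show (m : ℤ) < (m + 1 : ℕ) by omega),
      tau_of_lt σ _ _ (show (m : ℤ) - 1 < (m + 1 : ℕ) by omega)]
    set F := eS σ (m + 1) * gX σ (2 * m + 3) * gXi σ 1 with hF
    set G := eS σ m * gX σ (2 * m + 1) * gXi σ 1 with hG
    have key : scal (σ ^ (2 * m + 1)) * (xv * F
          - scal ((σ ^ (2 * m) + σ ^ (2 * (m + 1))) * σ ^ (2 * (m + 1))) * (zv * (xv * (xv * F)))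
          + scal (σ ^ (2 * (2 * m + 1 + 2 * (m + 1)))) * (zv * (zv * (xv * (xv * (xv * F))))))
        = scal (σ ^ (2 * m + 1)) * (zv * G) + scal (σ ^ (4 * m + 2)) * (zv * (zv * G))
          + scal (σ ^ (2 * m + 1)) * (xv * (eS σ m * gX σ (2 * m + 1)))
          + scal (σ ^ (4 * m + 2)) * (zv * (xv * (eS σ m * gX σ (2 * m + 1)))) := by
      have h1 := gXi_succ σ 0
      rw [show gXi σ 0 = 1 from gSer_zero _ _ _] at h1
      simp only [mul_zero, pow_zero, one_mul, zero_add] at h1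
      rw [hF, hG, eS_succ, ← gX_succ σ (2 * m + 1), ← gX_succ σ (2 * m + 2)]
      simp only [map_add, map_mul, map_pow]
      set D := eS σ m * gX σ (2 * m + 3) * (1 - scal σ ^ (2 * (2 * m + 2)) * (zv * xv))
        * (1 - scal σ ^ (2 * (2 * m + 1)) * (zv * xv)) * scal σ ^ (2 * m + 1)
        * (1 + scal σ ^ (2 * m + 1) * zv) with hD
      have h2 : D * (xv - zv) * gXi σ 1 = D * xv := by
        linear_combination D * xv * h1 + D * zv * gXi σ 1 * xv_mul_xi
      rw [hD] at h2
      linear_combination h2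
    have := congrArg (zxCoeff L a) key
    simp only [zxCoeff_add, zxCoeff_sub, zxCoeff_scal_mul, zxCoeff_zv_mul, zxCoeff_xv_mul,
      sub_sub, add_assoc, one_add_one_eq_two,
      zxCoeff_eS_mul_gX σ _ (show 0 < a + 1 by omega)] at this ⊢
    norm_num at this ⊢
    linear_combination this
  · obtain ⟨r, rfl⟩ := Nat.exists_eq_add_of_lt h
    have c2 : ∀ L a : ℤ, tau σ L (b + r + 1 : ℕ) a b
        = zxCoeff L a (eS σ (b + r + 1) * gX σ (2 * b + r + 2) * gXi σ (r + 2)) := fun L a => by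
      rw [tau_add σ L a b (r + 1) (by push_cast; ring)]
      congr 4
    have c3 : ∀ L a : ℤ, tau σ L (((b + r + 1 : ℕ) : ℤ) - 1) a b
        = zxCoeff L a (eS σ (b + r) * gX σ (2 * b + r + 1) * gXi σ (r + 1)) := fun L a =>
      tau_add σ L a b r (by push_cast; ring)
    have b1 : ∀ L a : ℤ, tau σ L (b + r + 1 + 1 : ℕ) a (b + 1)
        = zxCoeff L a (eS σ (b + r + 2) * gX σ (2 * b + r + 4) * gXi σ (r + 2)) := fun L a => by
      rw [tau_add σ L a (b + 1) (r + 1) (by push_cast; ring)]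
      congr 4 <;> ring
    have b2 : ∀ L a : ℤ, tau σ L (b + r + 1 : ℕ) a (b + 1)
        = zxCoeff L a (eS σ (b + r + 1) * gX σ (2 * b + r + 3) * gXi σ (r + 1)) := fun L a => by
      rw [tau_add σ L a (b + 1) r (by push_cast; ring)]
      congr 4 <;> ring
    have b3 : tau σ L (((b + r + 1 : ℕ) : ℤ) - 1) (a + 1) (b + 1)
        = zxCoeff L (a + 1) (eS σ (b + r) * gX σ (2 * b + r + 2) * gXi σ r) := by
      -- For r = 0 the left side is zero by convention, while the series on the right has no
      -- denominator in z/x, hence no negative power of x. So the generic formula persists.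
      rcases r with _ | r
      · rw [show gXi σ 0 = 1 from gSer_zero _ _ _, mul_one,
          zxCoeff_eS_mul_gX σ _ (show 0 < a + 1 by omega), tau_of_lt]
        push_cast; omega
      · rw [tau_add σ L _ (b + 1) r (by push_cast; ring)]
        congr 4 <;> ring
    simp only [c2, c3, b1, b2, b3]
    set F := eS σ (b + r + 2) * gX σ (2 * b + r + 4) * gXi σ (r + 2) with hF
    set G := eS σ (b + r + 1) * gX σ (2 * b + r + 3) * gXi σ (r + 1) with hG
    set H := eS σ (b + r) * gX σ (2 * b + r + 2) * gXi σ r with hH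
    set F' := eS σ (b + r + 1) * gX σ (2 * b + r + 2) * gXi σ (r + 2) with hF'
    set G' := eS σ (b + r) * gX σ (2 * b + r + 1) * gXi σ (r + 1) with hG'
    have key : scal (σ ^ (2 * b + 1)) * (xv * F - scal (1 + σ ^ 2) * (xv * G)
          + scal (σ ^ 2) * (xv * H)
          - scal ((σ ^ (2 * b) + σ ^ (2 * (b + 1))) * σ ^ (2 * (b + r + 1 + 1))) *
            (zv * (xv * (xv * F)) - zv * (xv * (xv * G)))
          + scal (σ ^ (2 * (2 * b + 1 + 2 * (b + r + 1 + 1)))) *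
            (zv * (zv * (xv * (xv * (xv * F))))))
        = scal (σ ^ (2 * (b + r + 1) + 1)) * (zv * F' - zv * G')
          + scal (σ ^ (4 * (b + r + 1) + 2)) * (zv * (zv * F')) := by
      have h := second_difference_identity (scal σ) (scal σ ^ (2 * r)) (scal σ ^ (2 * b))
        zv xv xi xv_mul_xi
      rw [hF, hG, hH, hF', hG', eS_succ σ (b + r + 1), eS_succ σ (b + r),
        ← gX_succ σ (2 * b + r + 1), ← gX_succ σ (2 * b + r + 2), ← gX_succ σ (2 * b + r + 3),
        ← gXi_succ σ r, ← gXi_succ σ (r + 1), ← gXi_succ σ (r + 2)]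
      simp only [map_add, map_mul, map_pow, map_one]
      linear_combination (eS σ (b + r) * gX σ (2 * b + r + 4) * gXi σ (r + 3)) * h
    have := congrArg (zxCoeff L a) key
    simp only [zxCoeff_add, zxCoeff_sub, zxCoeff_scal_mul, zxCoeff_zv_mul, zxCoeff_xv_mul,
      sub_sub, add_assoc, one_add_one_eq_two] at this ⊢
    norm_num at this ⊢
    linear_combination this

/-! ### The transformation of refined q-trinomial coefficients -/

/-- The sum transforming refined `q`-trinomial coefficients into each other,
with upper index `n = L + 1`. -/
noncomputable def tauSum (σ : ℂ) (N n : ℕ) (M a : ℤ) (b : ℕ) : ℂ :=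
  ∑ i ∈ Finset.range N, σ ^ (i ^ 2) * gamz (σ ^ 2) n (M - i) * tau σ ((n : ℤ) - 1 - i) i a b

theorem tauSum_of_neg (σ : ℂ) (N n : ℕ) {M : ℤ} (a : ℤ) (b : ℕ) (h : M < 0) :
    tauSum σ N n M a b = 0 :=
  Finset.sum_eq_zero fun i _ => by rw [gamz_of_neg _ _ (by omega)]; ring

/-- Differences in M bring every `gamz` to the index n (`gamz_second_difference`, `gamz_sub_gamz`).
Then `tau_succ_zero` converts the term i + 1 on the left into the term i on the right, hence the
ranges N + 1 and N. -/
theorem tauSum_zero_right {σ : ℂ} (hσ : ‖σ ^ 2‖ < 1) (N n m : ℕ) (a : ℤ) :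
    tauSum σ (N + 1) (n + 2) (m + 1 : ℕ) a 0 - (1 + σ ^ 2) * tauSum σ (N + 1) (n + 2) m a 0
      + σ ^ 2 * tauSum σ (N + 1) (n + 2) ((m : ℤ) - 1) a 0
      - σ ^ (2 * (m + 1)) * (tauSum σ (N + 1) (n + 1) (m + 1 : ℕ) (a + 1) 0
          - tauSum σ (N + 1) (n + 1) m (a + 1) 0
        + (tauSum σ (N + 1) (n + 1) (m + 1 : ℕ) (a - 1) 0 - tauSum σ (N + 1) (n + 1) m (a - 1) 0))
      + σ ^ (4 * (m + 1)) * tauSum σ (N + 1) n (m + 1 : ℕ) a 0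
      = σ ^ (2 * m + 1) * (tauSum σ N (n + 1) m a 0 - tauSum σ N (n + 1) ((m : ℤ) - 1) a 0)
        + σ ^ (4 * m + 2) * tauSum σ N n m a 0 := by
  have hz : ∀ L a : ℤ, tau σ L (0 : ℕ) a 0
      - (tau σ (L - 1) (0 : ℕ) (a + 1) 0 + tau σ (L - 1) (0 : ℕ) (a - 1) 0)
      + tau σ (L - 2) (0 : ℕ) a 0 = if L = 0 ∧ a = 0 then 1 else 0 := by
    intro L a
    have e2 : ∀ L a : ℤ, tau σ L (0 : ℕ) a 0 = zxCoeff L a (eS σ 0 * gX σ 1 * gXi σ 1) :=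
      fun L a => tau_add σ L a 0 0 (by simp)
    have h2 := gX_succ σ 0
    have h3 := gXi_succ σ 0
    simp only [mul_zero, pow_zero, one_mul, zero_add] at h2 h3
    rw [show gX σ 0 = 1 from gSer_zero _ _ _] at h2
    rw [show gXi σ 0 = 1 from gSer_zero _ _ _] at h3
    simp only [e2]
    rw [show eS σ 0 = 1 from eSer_zero _ _ _, ← zxCoeff_one]
    set G := 1 * gX σ 1 * gXi σ 1 with hG
    have key : G - (zv * (xv * G) + zv * (xi * G)) + zv * (zv * G) = 1 := by
      rw [hG]
      linear_combination (gXi σ 1 * (1 - zv * xi)) * h2 + h3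
        - zv ^ 2 * gX σ 1 * gXi σ 1 * xv_mul_xi
    have := congrArg (zxCoeff L a) key
    simpa only [zxCoeff_add, zxCoeff_sub, zxCoeff_zv_mul, zxCoeff_xv_mul,
      zxCoeff_xi_mul, sub_sub, one_add_one_eq_two] using this
  unfold tauSum
  simp only [Finset.mul_sum, ← Finset.sum_add_distrib, ← Finset.sum_sub_distrib]
  rw [Finset.sum_range_succ']
  have h0 : ∀ x y : ℂ, y = 0 → x = x + y := by intro x y h; simp [h]
  symm
  apply (h0 _ _ _).trans
  · congr 1
    · refine Finset.sum_congr rfl fun i _ => ?_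
      rcases le_or_gt i m with h | h
      · obtain ⟨r, rfl⟩ := Nat.exists_eq_add_of_le h
        have g2 := gamz_second_difference hσ n r
        have g1 := gamz_sub_gamz hσ n r
        have t := tau_succ_zero σ ((n : ℤ) - i) a i
        have i1 : ((i + r + 1 : ℕ) : ℤ) - ((i + 1 : ℕ) : ℤ) = r := by push_cast; ring
        have i2 : ((i + r : ℕ) : ℤ) - ((i + 1 : ℕ) : ℤ) = r - 1 := by push_cast; ring
        have i3 : ((i + r : ℕ) : ℤ) - 1 - ((i + 1 : ℕ) : ℤ) = r - 2 := by push_cast; ring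
        have i4 : ((i + r : ℕ) : ℤ) - (i : ℤ) = r := by push_cast; ring
        have i5 : ((i + r : ℕ) : ℤ) - 1 - (i : ℤ) = r - 1 := by push_cast; ring
        have i6 : ((n + 2 : ℕ) : ℤ) - 1 - ((i + 1 : ℕ) : ℤ) = n - i := by push_cast; ring
        have i7 : ((n + 1 : ℕ) : ℤ) - 1 - ((i + 1 : ℕ) : ℤ) = n - i - 1 := by push_cast; ring
        have i8 : (n : ℤ) - 1 - ((i + 1 : ℕ) : ℤ) = n - i - 2 := by push_cast; ring
        have i9 : ((n + 1 : ℕ) : ℤ) - 1 - (i : ℤ) = n - i := by push_cast; ring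
        have i10 : (n : ℤ) - 1 - (i : ℤ) = n - i - 1 := by ring
        rw [i1, i2, i3, i4, i5, i6, i7, i8, i9, i10]
        linear_combination (-σ ^ ((i + 1) ^ 2) * tau σ (n - i) (i + 1 : ℕ) a 0) * g2
          + (σ ^ (2 * (i + r) + 1) * σ ^ (i ^ 2) * tau σ (n - i) i a 0
            + σ ^ (2 * (i + r + 1)) * σ ^ ((i + 1) ^ 2) *
              (tau σ (n - i - 1) (i + 1 : ℕ) (a + 1) 0 + tau σ (n - i - 1) (i + 1 : ℕ) (a - 1) 0))
            * g1
          - σ ^ (4 * r) * σ ^ ((i + 1) ^ 2) * gamz (σ ^ 2) n r * t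
      · simp only [gamz_of_neg _ _ (show ((m + 1 : ℕ) : ℤ) - ((i + 1 : ℕ) : ℤ) < 0 by omega),
          gamz_of_neg _ _ (show (m : ℤ) - ((i + 1 : ℕ) : ℤ) < 0 by omega),
          gamz_of_neg _ _ (show (m : ℤ) - 1 - ((i + 1 : ℕ) : ℤ) < 0 by omega),
          gamz_of_neg _ _ (show (m : ℤ) - (i : ℤ) < 0 by omega),
          gamz_of_neg _ _ (show (m : ℤ) - 1 - (i : ℤ) < 0 by omega)]
        ring
  -- The term i = 0 has no partner on the right. By `hz` it is supported at L = 0, whereas here L =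
  -- n + 1.
  · have g2 := gamz_second_difference hσ n (m + 1)
    have g1 := gamz_sub_gamz hσ n (m + 1)
    have t := hz ((n : ℤ) + 1) a
    rw [if_neg (by omega)] at t
    have i1 : ((m + 1 : ℕ) : ℤ) - ((0 : ℕ) : ℤ) = (m + 1 : ℕ) := by simp
    have i2 : (m : ℤ) - ((0 : ℕ) : ℤ) = (m + 1 : ℕ) - 1 := by push_cast; ring
    have i3 : (m : ℤ) - 1 - ((0 : ℕ) : ℤ) = (m + 1 : ℕ) - 2 := by push_cast; ring
    have i6 : ((n + 2 : ℕ) : ℤ) - 1 - ((0 : ℕ) : ℤ) = n + 1 := by push_cast; ring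
    have i7 : ((n + 1 : ℕ) : ℤ) - 1 - ((0 : ℕ) : ℤ) = n + 1 - 1 := by push_cast; ring
    have i8 : (n : ℤ) - 1 - ((0 : ℕ) : ℤ) = n + 1 - 2 := by push_cast; ring
    rw [i1, i2, i3, i6, i7, i8]
    linear_combination tau σ (n + 1) (0 : ℕ) a 0 * g2
      - σ ^ (2 * (m + 1)) * (tau σ (n + 1 - 1) (0 : ℕ) (a + 1) 0
        + tau σ (n + 1 - 1) (0 : ℕ) (a - 1) 0) * g1
      + σ ^ (4 * (m + 1)) * gamz (σ ^ 2) n (m + 1 : ℕ) * t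

/-- As for b = 0, with `tau_succ_succ` lowering i and b together. The unpaired term i = 0 vanishes
because 0 < b + 1. -/
theorem tauSum_succ_right {σ : ℂ} (hσ : ‖σ ^ 2‖ < 1) (N n m b : ℕ) (a : ℤ) :
    tauSum σ (N + 1) (n + 2) (m + 1 : ℕ) a (b + 1)
      - (1 + σ ^ 2) * tauSum σ (N + 1) (n + 2) m a (b + 1)
      + σ ^ 2 * tauSum σ (N + 1) (n + 2) ((m : ℤ) - 1) a (b + 1)
      - (σ ^ (2 * b) + σ ^ (2 * (b + 1))) * σ ^ (2 * (m + 1)) *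
        (tauSum σ (N + 1) (n + 1) (m + 1 : ℕ) (a + 1) (b + 1)
          - tauSum σ (N + 1) (n + 1) m (a + 1) (b + 1))
      + σ ^ (2 * (2 * b + 1 + 2 * (m + 1))) * tauSum σ (N + 1) n (m + 1 : ℕ) (a + 2) (b + 1)
      = σ ^ (2 * m + 1) * (tauSum σ N (n + 1) m a b - tauSum σ N (n + 1) ((m : ℤ) - 1) a b)
        + σ ^ (4 * m + 2) * tauSum σ N n m a b := by
  unfold tauSum
  simp only [Finset.mul_sum, ← Finset.sum_add_distrib, ← Finset.sum_sub_distrib]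
  rw [Finset.sum_range_succ']
  simp only [tau_of_lt σ _ _ (show ((0 : ℕ) : ℤ) < ((b + 1 : ℕ) : ℤ) by omega), mul_zero,
    sub_zero, add_zero]
  refine Finset.sum_congr rfl fun i _ => ?_
  rcases le_or_gt i m with h | h
  · obtain ⟨r, rfl⟩ := Nat.exists_eq_add_of_le h
    have g2 := gamz_second_difference hσ n r
    have g1 := gamz_sub_gamz hσ n r
    have t := tau_succ_succ σ ((n : ℤ) - i) a i b
    have i1 : ((i + r + 1 : ℕ) : ℤ) - ((i + 1 : ℕ) : ℤ) = r := by push_cast; ring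
    have i2 : ((i + r : ℕ) : ℤ) - ((i + 1 : ℕ) : ℤ) = r - 1 := by push_cast; ring
    have i3 : ((i + r : ℕ) : ℤ) - 1 - ((i + 1 : ℕ) : ℤ) = r - 2 := by push_cast; ring
    have i4 : ((i + r : ℕ) : ℤ) - (i : ℤ) = r := by push_cast; ring
    have i5 : ((i + r : ℕ) : ℤ) - 1 - (i : ℤ) = r - 1 := by push_cast; ring
    have i6 : ((n + 2 : ℕ) : ℤ) - 1 - ((i + 1 : ℕ) : ℤ) = n - i := by push_cast; ring
    have i7 : ((n + 1 : ℕ) : ℤ) - 1 - ((i + 1 : ℕ) : ℤ) = n - i - 1 := by push_cast; ring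
    have i8 : (n : ℤ) - 1 - ((i + 1 : ℕ) : ℤ) = n - i - 2 := by push_cast; ring
    have i9 : ((n + 1 : ℕ) : ℤ) - 1 - (i : ℤ) = n - i := by push_cast; ring
    have i10 : (n : ℤ) - 1 - (i : ℤ) = n - i - 1 := by ring
    rw [i1, i2, i3, i4, i5, i6, i7, i8, i9, i10]
    linear_combination (σ ^ ((i + 1) ^ 2) * tau σ (n - i) (i + 1 : ℕ) a (b + 1)) * g2
      - (σ ^ (2 * (i + r) + 1) * σ ^ (i ^ 2) * tau σ (n - i) i a b
        + (σ ^ (2 * b) + σ ^ (2 * (b + 1))) * σ ^ (2 * (i + r + 1)) * σ ^ ((i + 1) ^ 2) *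
          tau σ (n - i - 1) (i + 1 : ℕ) (a + 1) (b + 1)) * g1
      + σ ^ (4 * r) * σ ^ ((i + 1) ^ 2) * gamz (σ ^ 2) n r * t
  · simp only [gamz_of_neg _ _ (show ((m + 1 : ℕ) : ℤ) - ((i + 1 : ℕ) : ℤ) < 0 by omega),
      gamz_of_neg _ _ (show (m : ℤ) - ((i + 1 : ℕ) : ℤ) < 0 by omega),
      gamz_of_neg _ _ (show (m : ℤ) - 1 - ((i + 1 : ℕ) : ℤ) < 0 by omega),
      gamz_of_neg _ _ (show (m : ℤ) - (i : ℤ) < 0 by omega),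
      gamz_of_neg _ _ (show (m : ℤ) - 1 - (i : ℤ) < 0 by omega)]
    ring

theorem tau_index_zero (σ : ℂ) (m b : ℕ) {a : ℤ} (h : m < b → a ≠ 0) :
    tau σ 0 m a b = if a = 0 then 1 else 0 := by
  unfold tau zxCoeff
  by_cases hb : b ≤ m
  · rw [if_pos (by exact_mod_cast hb), if_pos le_rfl, Int.toNat_zero]
    have h1 : (PowerSeries.coeff 0) (eS σ (m : ℤ).toNat * gX σ ((m : ℤ).toNat + b + 1) *
        gXi σ ((m : ℤ).toNat - b + 1)) = LaurentPolynomial.T 0 := by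
      rw [LaurentPolynomial.T_zero]
      simp [eS, gX, gXi, eSer, gSer]
    rw [h1, LaurentPolynomial.T_apply]
    simp [eq_comm]
  · rw [if_neg (by exact_mod_cast hb), if_neg (h (by omega))]

theorem gamz_one (p : ℂ) (m : ℕ) : gamz p 1 m = 1 := by
  rw [gamz_natCast, gam, zero_add, gauss_self]

/-- The uniqueness principle for `tauSum_eq`, applied to the difference of its two sides as a
function of M. -/
theorem eq_zero_of_second_difference {p : ℂ} {f : ℤ → ℂ} (hneg : ∀ M < 0, f M = 0)
    (h0 : f 0 = 0)
    (h : ∀ m : ℕ, f (m + 1 : ℕ) - (1 + p) * f m + p * f ((m : ℤ) - 1) = 0) (M : ℤ) :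
    f M = 0 := by
  have key : ∀ m : ℕ, f m = 0 ∧ f ((m : ℤ) - 1) = 0 := by
    intro m
    induction m with
    | zero => exact ⟨by simpa using h0, hneg _ (by simp)⟩
    | succ m ih =>
      have h1 : f (m + 1 : ℕ) = 0 := by linear_combination h m + (1 + p) * ih.1 - p * ih.2
      refine ⟨h1, ?_⟩
      rw [show ((m + 1 : ℕ) : ℤ) - 1 = m by push_cast; ring]
      exact ih.1
  rcases lt_or_ge M 0 with hM | hM
  · exact hneg M hM
  · obtain ⟨m, rfl⟩ := Int.eq_ofNat_of_zero_le hM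
    exact (key m).1

theorem tauSum_one (σ : ℂ) (N b : ℕ) (M : ℤ) {a : ℤ} (h : 0 < b → 0 ≤ a) :
    tauSum σ (N + 1) 1 M a b = σ ^ (b ^ 2) * tau σ 0 M (a + b) b := by
  rcases lt_or_ge M 0 with hM | hM
  · rw [tauSum_of_neg _ _ _ _ _ hM, tau_of_lt σ _ _ (by omega), mul_zero]
  obtain ⟨m, rfl⟩ := Int.eq_ofNat_of_zero_le hM
  rw [tauSum, Finset.sum_range_succ', Finset.sum_eq_zero]
  · rcases b with _ | b
    · have h1 := tau_index_zero σ 0 0 (a := a) (by simp)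
      have h2 := tau_index_zero σ m 0 (a := a) (by simp)
      have h3 := gamz_one (σ ^ 2) m
      simp at h1 h2 h3 ⊢
      rw [h1, h2, h3, one_mul]
    · have h1 : a + ((b + 1 : ℕ) : ℤ) ≠ 0 := by have := h (by omega); omega
      rw [tau_of_lt σ _ _ (by simp), tau_index_zero _ _ _ fun _ => h1,
        if_neg h1]
      simp
  · intro i _
    rw [tau_of_neg σ _ _ _ (by push_cast; omega), mul_zero]

/-- The transformation of refined `q`-trinomial coefficients. -/
theorem tauSum_eq {σ : ℂ} (hσ : ‖σ ^ 2‖ < 1) (b : ℕ) :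
    ∀ (n N : ℕ) (M a : ℤ), n ≤ N → (0 < b → 0 ≤ a) →
      tauSum σ N n M a b = σ ^ (b ^ 2) * tau σ ((n : ℤ) - 1) M (a + b) b := by
  induction b with
  | zero =>
    intro n
    induction n using Nat.twoStepInduction with
    | zero =>
      intro N M a _ _
      rw [tau_of_neg σ _ _ _ (by simp), mul_zero]
      exact Finset.sum_eq_zero fun i _ => by rw [tau_of_neg σ _ _ _ (by omega), mul_zero]
    | one =>
      intro N M a hN h
      obtain ⟨N, rfl⟩ := Nat.exists_eq_add_of_le' hN
      simpa using tauSum_one σ N 0 M h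
    | more n ih0 ih1 =>
      intro N M a hN _
      obtain ⟨N, rfl⟩ := Nat.exists_eq_add_of_le' (show 1 ≤ N by omega)
      rw [← sub_eq_zero]
      revert M
      refine eq_zero_of_second_difference (p := σ ^ 2) ?_ ?_ ?_
      · intro M hM
        rw [tauSum_of_neg _ _ _ _ _ hM, tau_of_lt σ _ _ (by omega), mul_zero, sub_zero]
      · rw [tauSum, Finset.sum_range_succ', Finset.sum_eq_zero]
        · have := gamz_natCast (σ ^ 2) (n + 2) 0
          simp at this ⊢
          rw [this]
          ring
        · intro i _
          rw [gamz_of_neg _ _ (by omega)]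
          ring
      · intro m
        -- The smaller values n and n + 1 are known by induction. After they are inserted, the
        -- recursions for the two sides differ only in the terms with L = n + 1, that is, in the
        -- difference under study.
        have h1 := tauSum_zero_right hσ N n m a
        have h2 := tau_zero_second_difference σ ((n : ℤ) + 1) a m
        rw [if_neg (show ¬ ((n : ℤ) + 1 = 0 ∧ a = 0) by omega)] at h2
        simp only [ih0 _ _ _ (show n ≤ N + 1 by omega) (by simp),
          ih0 _ _ _ (show n ≤ N by omega) (by simp),
          ih1 _ _ _ (show n + 1 ≤ N + 1 by omega) (by simp),
          ih1 _ _ _ (show n + 1 ≤ N by omega) (by simp)] at h1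
        push_cast at h1 h2 ⊢
        simp only [show (n : ℤ) + 2 - 1 = n + 1 by ring, show (n : ℤ) + 1 - 1 = n by ring,
          show (n : ℤ) + 1 - 2 = n - 1 by ring, add_zero, mul_zero, ite_self, sub_zero, pow_zero,
          one_mul] at h1 h2 ⊢
        linear_combination h1 - h2
  | succ b ihb =>
    intro n
    induction n using Nat.twoStepInduction with
    | zero =>
      intro N M a _ _
      rw [tau_of_neg σ _ _ _ (by simp), mul_zero]
      exact Finset.sum_eq_zero fun i _ => by rw [tau_of_neg σ _ _ _ (by omega), mul_zero]
    | one =>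
      intro N M a hN h
      obtain ⟨N, rfl⟩ := Nat.exists_eq_add_of_le' hN
      simpa using tauSum_one σ N (b + 1) M h
    | more n ih0 ih1 =>
      intro N M a hN ha
      replace ha : 0 ≤ a := ha (by omega)
      obtain ⟨N, rfl⟩ := Nat.exists_eq_add_of_le' (show 1 ≤ N by omega)
      rw [← sub_eq_zero]
      revert M
      refine eq_zero_of_second_difference (p := σ ^ 2) ?_ ?_ ?_
      · intro M hM
        rw [tauSum_of_neg _ _ _ _ _ hM, tau_of_lt σ _ _ (by omega), mul_zero, sub_zero]
      · rw [tau_of_lt σ _ _ (by omega), mul_zero, sub_zero]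
        rw [tauSum, Finset.sum_range_succ', Finset.sum_eq_zero]
        · rw [tau_of_lt σ _ _ (by simp)]
          ring
        · intro i _
          rw [gamz_of_neg _ _ (by omega)]
          ring
      · intro m
        -- Here the right sides involve b rather than b + 1 and are supplied by the outer induction.
        have h1 := tauSum_succ_right hσ N n m b a
        have h2 := tau_second_difference σ ((n : ℤ) + 1) (show 0 ≤ a + b by omega) m b
        simp only [ih0 _ _ _ (show n ≤ N + 1 by omega) (fun _ => show 0 ≤ a + 2 by omega),
          ih1 _ _ _ (show n + 1 ≤ N + 1 by omega) (fun _ => show 0 ≤ a + 1 by omega),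
          ihb _ _ _ _ (show n ≤ N by omega) (fun _ => ha),
          ihb _ _ _ _ (show n + 1 ≤ N by omega) (fun _ => ha)] at h1
        push_cast at h1 h2 ⊢
        simp only [show (n : ℤ) + 2 - 1 = n + 1 by ring, show (n : ℤ) + 1 - 1 = n by ring,
          show (n : ℤ) + 1 - 2 = n - 1 by ring, show a + 1 + ((b : ℤ) + 1) = a + b + 2 by ring,
          show a + 2 + ((b : ℤ) + 1) = a + b + 3 by ring, ← add_assoc] at h1 h2 ⊢
        linear_combination h1 - σ ^ (b ^ 2) * h2

/-! ### The seed identity: the sum over m for a single n -/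

theorem pow_mul_sq_pow_choose (σ : ℂ) (k : ℕ) : σ ^ k * (σ ^ 2) ^ (k.choose 2) = σ ^ (k ^ 2) := by
  rw [← pow_mul, ← pow_add]
  congr 1
  have h2 := Nat.choose_two_right k
  have h3 : 2 * (k * (k - 1) / 2) = k * (k - 1) :=
    Nat.mul_div_cancel' (Nat.even_mul_pred_self k).two_dvd
  rw [h2, h3]
  cases k with
  | zero => simp
  | succ k => simp; ring

theorem tau_natCast (σ : ℂ) (L M a b : ℕ) (hb : b ≤ M) :
    tau σ L M a b = ∑ u ∈ antidiagonal L, σ ^ (u.1 ^ 2) * gauss (σ ^ 2) M u.1 *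
      ∑ v ∈ antidiagonal u.2,
        if v.2 = v.1 + a then gam (σ ^ 2) (M + b + 1) v.1 * gam (σ ^ 2) (M - b + 1) v.2 else 0 := by
  rw [tau, if_pos (by exact_mod_cast hb), zxCoeff, if_pos (by simp), Int.toNat_natCast,
    Int.toNat_natCast, mul_assoc, PowerSeries.coeff_mul, AddMonoidAlgebra.coeff_sum,
    Finsupp.finsetSum_apply]
  refine Finset.sum_congr rfl fun u _ => ?_
  rw [eS, eSer, PowerSeries.coeff_mk, ← LaurentPolynomial.smul_eq_C_mul, pow_mul_sq_pow_choose,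
    AddMonoidAlgebra.coeff_smul, Finsupp.smul_apply, smul_eq_mul, PowerSeries.coeff_mul,
    AddMonoidAlgebra.coeff_sum, Finsupp.finsetSum_apply]
  congr 1
  refine Finset.sum_congr rfl fun v _ => ?_
  simp only [gX, gXi, gSer, PowerSeries.coeff_mk]
  have h : ∀ (c d : ℂ) (m n : ℤ), LaurentPolynomial.C c * LaurentPolynomial.T m *
      (LaurentPolynomial.C d * LaurentPolynomial.T n)
      = LaurentPolynomial.C (c * d) * LaurentPolynomial.T (m + n) := fun c d m n => by
    rw [LaurentPolynomial.T_add, map_mul]; ring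
  rw [LaurentPolynomial.T_pow, LaurentPolynomial.T_pow, h, laurent_coeff_mul_T,
    LaurentPolynomial.C_apply]
  split_ifs <;> first | rfl | omega

theorem gauss_diag_eq_zero (p : ℂ) {M k e : ℕ} (h : M + k < e ∨ M + e < k) :
    gauss p (M + e) k * gauss p (M + k) e = 0 := by
  rcases h with h | h
  · rw [gauss_of_lt p h, mul_zero]
  · rw [gauss_of_lt p h, zero_mul]

/-- For a = b = j ≥ 0 the condition v₂ = v₁ + j turns the two upper indices into M + v₂ and M + v₁.
The product is then symmetric under swapping v, which covers negative j, and it vanishes by itself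
when |j| > M. -/
theorem tau_diag (σ : ℂ) (L M : ℕ) (j : ℤ) :
    tau σ L M |j| j.natAbs = ∑ u ∈ antidiagonal L, σ ^ (u.1 ^ 2) * gauss (σ ^ 2) M u.1 *
      ∑ v ∈ antidiagonal u.2, if (v.2 : ℤ) - v.1 = j then
        gauss (σ ^ 2) (M + v.2) v.1 * gauss (σ ^ 2) (M + v.1) v.2 else 0 := by
  have pos : ∀ j : ℕ, tau σ L M j j = ∑ u ∈ antidiagonal L, σ ^ (u.1 ^ 2) * gauss (σ ^ 2) M u.1 *
      ∑ v ∈ antidiagonal u.2, if v.2 = v.1 + j then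
        gauss (σ ^ 2) (M + v.2) v.1 * gauss (σ ^ 2) (M + v.1) v.2 else 0 := by
    intro j
    rcases le_or_gt j M with h | h
    · rw [tau_natCast σ L M j j h]
      refine Finset.sum_congr rfl fun u _ => ?_
      congr 1
      refine Finset.sum_congr rfl fun v _ => ?_
      split_ifs with hv
      · simp only [gam]
        rw [show M + j + v.1 = M + v.2 by omega, show M - j + v.2 = M + v.1 by omega]
      · rfl
    · rw [tau_of_lt σ _ _ (by exact_mod_cast h)]
      symm
      refine Finset.sum_eq_zero fun u _ => ?_
      rw [Finset.sum_eq_zero, mul_zero]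
      intro v _
      split_ifs with hv
      · exact gauss_diag_eq_zero _ (Or.inl (by omega))
      · rfl
  rw [← Int.natCast_natAbs, pos]
  refine Finset.sum_congr rfl fun u _ => ?_
  congr 1
  rcases le_total 0 j with h | h
  · refine Finset.sum_congr rfl fun v _ => ?_
    split_ifs <;> first | rfl | omega
  · rw [← Finset.Nat.sum_antidiagonal_swap]
    refine Finset.sum_congr rfl fun v _ => ?_
    simp only [Prod.fst_swap, Prod.snd_swap]
    split_ifs <;> first | omega | ring

/-- The weight of the index `j` of the theta series. -/
noncomputable def wt (s : ℂ) (j : ℤ) : ℂ := s ^ (3 * j ^ 2 + 2 * j).toNat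

theorem wt_exponent_nonneg (x : ℤ) : 0 ≤ 3 * x ^ 2 + 2 * x := by
  have : 0 ≤ x * (x + 1) := by
    rcases lt_or_ge x 0 with h | h
    · exact mul_nonneg_of_nonpos_of_nonpos h.le (by omega)
    · positivity
  nlinarith [sq_nonneg x]

/-- Comparison of exponents: (3α² + 2α) + (3β² - 2β) = 3(α-β)² + 2(α-β) + 6αβ. -/
theorem wt_sub_mul (s : ℂ) (α β : ℕ) :
    (s ^ 5) ^ α * ((s ^ 3) ^ 2) ^ (α.choose 2) * (s ^ β * ((s ^ 3) ^ 2) ^ (β.choose 2))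
      = wt s ((α : ℤ) - β) * ((s ^ 3) ^ 2) ^ (α * β) := by
  simp only [wt, ← pow_mul, ← pow_add]
  congr 1
  have h : ∀ n : ℕ, ((n.choose 2 : ℕ) : ℤ) * 2 = n * (n - 1) := by
    intro n
    induction n with
    | zero => simp
    | succ n ih => rw [Nat.choose_succ_succ' n 1]; push_cast; linarith [Nat.choose_one_right n, ih]
  have h1 := h α
  have h2 := h β
  have h3 : 0 ≤ 3 * ((α : ℤ) - β) ^ 2 + 2 * ((α : ℤ) - β) := wt_exponent_nonneg _
  zify
  rw [Int.toNat_of_nonneg h3]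
  linear_combination 3 * h1 + 3 * h2

/-- The odd exponents below 6M are sorted by their residue 3, 5 or 1 modulo 6. -/
theorem eSer_mul_three (s : ℂ) (M : ℕ) :
    eSer (RingHom.id ℂ) (s ^ 2) s (3 * M) =
      eSer (RingHom.id ℂ) ((s ^ 3) ^ 2) (s ^ 3) M *
        (eSer (RingHom.id ℂ) ((s ^ 3) ^ 2) (s ^ 5) M *
          eSer (RingHom.id ℂ) ((s ^ 3) ^ 2) s M) := by
  induction M with
  | zero => simp [eSer_zero]
  | succ M ih =>
    rw [show 3 * (M + 1) = 3 * M + 1 + 1 + 1 by ring]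
    simp only [eSer_succ, ih, RingHom.id_apply, map_mul, map_pow]
    ring

/-- The even power series with coefficients `[n + r; r]`. -/
noncomputable def evenSer (p : ℂ) (n : ℕ) : PowerSeries ℂ :=
  PowerSeries.mk fun r => if Even r then gauss p (n + r / 2) (r / 2) else 0

/-- Let t, t' be the degrees taken from the two polynomials and 2l the degree from the even series.
With k = t' + l and e = t + l, `wt_sub_mul` gives the weight of e - k times the power (k-l)(e-l), so
for fixed k and e the sum over l is the Saalschütz sum. -/
theorem coeff_eSer_mul_eSer_mul_evenSer {s : ℂ} (hs : ‖(s ^ 3) ^ 2‖ < 1) (M N : ℕ) :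
    PowerSeries.coeff N (eSer (RingHom.id ℂ) ((s ^ 3) ^ 2) (s ^ 5) M *
          eSer (RingHom.id ℂ) ((s ^ 3) ^ 2) s M * evenSer ((s ^ 3) ^ 2) (2 * M))
      = ∑ v ∈ antidiagonal N, wt s ((v.2 : ℤ) - v.1) *
        (gauss ((s ^ 3) ^ 2) (M + v.2) v.1 * gauss ((s ^ 3) ^ 2) (M + v.1) v.2) := by
  simp only [← sum_gauss_mul_gauss_mul_gauss hs, PowerSeries.coeff_mul, Finset.sum_mul,
    Finset.mul_sum]
  rw [Finset.sum_sigma', Finset.sum_sigma']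
  simp only [evenSer, PowerSeries.coeff_mk, mul_ite, mul_zero]
  rw [← Finset.sum_filter]
  refine Finset.sum_bij' (fun x _ => ⟨(x.2.2 + x.1.2 / 2, x.2.1 + x.1.2 / 2), x.1.2 / 2⟩)
    (fun y _ => ⟨(y.1.1 + y.1.2 - 2 * y.2, 2 * y.2), (y.1.2 - y.2, y.1.1 - y.2)⟩) ?_ ?_ ?_ ?_ ?_
  · rintro ⟨⟨w, r⟩, t, t'⟩ h
    simp only [Finset.mem_filter, Finset.mem_sigma, mem_antidiagonal] at h
    obtain ⟨⟨h1, h2⟩, c, rfl⟩ := h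
    simp
    omega
  · rintro ⟨⟨k, e⟩, l⟩ h
    simp at h ⊢
    omega
  · rintro ⟨⟨w, r⟩, t, t'⟩ h
    simp only [Finset.mem_filter, Finset.mem_sigma, mem_antidiagonal] at h
    obtain ⟨⟨h1, h2⟩, c, rfl⟩ := h
    simp
    omega
  · rintro ⟨⟨k, e⟩, l⟩ h
    simp at h ⊢
    omega
  · rintro ⟨⟨w, r⟩, t, t'⟩ h
    simp only [Finset.mem_filter, Finset.mem_sigma, mem_antidiagonal] at h
    obtain ⟨⟨h1, h2⟩, c, rfl⟩ := h
    have e := wt_sub_mul s t t'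
    simp only [eSer, PowerSeries.coeff_mk, RingHom.id_apply,
      show (c + c) / 2 = c by omega, Nat.add_sub_cancel]
    push_cast
    rw [show (t : ℤ) + c - (t' + c) = t - t' by ring]
    linear_combination (gauss ((s ^ 3) ^ 2) M t * gauss ((s ^ 3) ^ 2) M t' *
      gauss ((s ^ 3) ^ 2) (2 * M + c) c) * e

/-- In `eSer_mul_three` the first factor is the numerator of `tau` for σ = s³; the other two and the
even series give the products in `tau_diag`. Any K ≥ M serves, since `tau` vanishes for |j| > M. -/
theorem sum_wt_mul_tau {s : ℂ} (hs : ‖(s ^ 3) ^ 2‖ < 1) (L M K : ℕ) (hK : M ≤ K) :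
    ∑ u ∈ antidiagonal L, s ^ (u.1 ^ 2) * gauss (s ^ 2) (3 * M) u.1 *
      (if Even u.2 then gauss ((s ^ 3) ^ 2) (2 * M + u.2 / 2) (u.2 / 2) else 0)
    = ∑ j ∈ Finset.Icc (-K : ℤ) K, wt s j * tau (s ^ 3) L M |j| j.natAbs := by
  have h1 : ∑ u ∈ antidiagonal L, s ^ (u.1 ^ 2) * gauss (s ^ 2) (3 * M) u.1 *
      (if Even u.2 then gauss ((s ^ 3) ^ 2) (2 * M + u.2 / 2) (u.2 / 2) else 0)
      = PowerSeries.coeff L (eSer (RingHom.id ℂ) (s ^ 2) s (3 * M) *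
        evenSer ((s ^ 3) ^ 2) (2 * M)) := by
    rw [PowerSeries.coeff_mul]
    refine Finset.sum_congr rfl fun u _ => ?_
    simp only [eSer, evenSer, PowerSeries.coeff_mk, RingHom.id_apply, pow_mul_sq_pow_choose]
  rw [h1, eSer_mul_three, mul_assoc, PowerSeries.coeff_mul]
  simp only [tau_diag, Finset.mul_sum]
  rw [Finset.sum_comm]
  refine Finset.sum_congr rfl fun u _ => ?_
  rw [coeff_eSer_mul_eSer_mul_evenSer hs, Finset.sum_comm, Finset.mul_sum]
  refine Finset.sum_congr rfl fun v _ => ?_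
  simp only [eSer, PowerSeries.coeff_mk, RingHom.id_apply, pow_mul_sq_pow_choose, mul_ite,
    mul_zero, Finset.sum_ite_eq, Finset.mem_Icc]
  split_ifs with h
  · ring
  · rw [gauss_diag_eq_zero _ (by omega)]
    ring

/-! ### The multisum for fixed i and N_1 -/

theorem qBinom_natCast {q : ℂ} (hq : ‖q‖ < 1) (A B : ℕ) : qBinom q A B = gauss q A B := by
  unfold qBinom
  split_ifs with h
  · obtain ⟨d, rfl⟩ := Nat.exists_eq_add_of_le (show B ≤ A by omega)
    rw [gauss_eq_div hq, Int.toNat_natCast, Int.toNat_natCast,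
      show (((B + d : ℕ) : ℤ) - B).toNat = d by omega]
  · rw [gauss_of_lt q (by omega)]

theorem qBinom_of_lt (q : ℂ) {A B : ℤ} (h : A < B) : qBinom q A B = 0 := by
  rw [qBinom, if_neg (by omega)]

theorem sum_Icc_one {A : Type*} [AddCommMonoid A] (f : ℕ → A) (n : ℕ) :
    ∑ k ∈ Finset.Icc 1 n, f k = ∑ k ∈ Finset.range n, f (k + 1) := by
  rw [Finset.range_eq_Ico, Finset.sum_Ico_add' f 0 n 1]
  rfl

theorem sum_Icc_one_succ {A : Type*} [AddCommMonoid A] (f : ℕ → A) (n : ℕ) :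
    ∑ k ∈ Finset.Icc 1 (n + 1), f k = f 1 + ∑ k ∈ Finset.Icc 1 n, f (k + 1) := by
  rw [sum_Icc_one, sum_Icc_one, Finset.sum_range_succ', add_comm]

theorem prod_Icc_one_succ {A : Type*} [CommMonoid A] (f : ℕ → A) (n : ℕ) :
    ∏ k ∈ Finset.Icc 1 (n + 1), f k = f 1 * ∏ k ∈ Finset.Icc 1 n, f (k + 1) :=
  sum_Icc_one_succ (A := Additive A) f n

theorem entry_cons_one {ν : ℕ} (a : ℕ) (n : Fin ν → ℕ) :
    entry (Fin.cons a n : Fin (ν + 1) → ℕ) 1 = a := by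
  rw [entry, dif_pos (by omega)]
  rfl

theorem entry_cons_succ {ν : ℕ} (a : ℕ) (n : Fin ν → ℕ) {k : ℕ} (hk : 1 ≤ k) :
    entry (Fin.cons a n : Fin (ν + 1) → ℕ) (k + 1) = entry n k := by
  obtain ⟨k, rfl⟩ := Nat.exists_eq_add_of_le' hk
  unfold entry
  by_cases h : k + 1 ≤ ν
  · rw [dif_pos (by omega), dif_pos (by omega)]
    exact Fin.cons_succ (α := fun _ => ℕ) a n ⟨k, by omega⟩
  · rw [dif_neg (by omega), dif_neg (by omega)]

theorem tailSum_cons_succ {ν : ℕ} (a : ℕ) (n : Fin ν → ℕ) {k : ℕ} (hk : 1 ≤ k) :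
    tailSum (Fin.cons a n : Fin (ν + 1) → ℕ) (k + 1) = tailSum n k := by
  unfold tailSum
  rw [← Finset.image_add_right_Icc k ν 1, Finset.sum_image (fun x _ y _ h => by simpa using h)]
  exact Finset.sum_congr rfl fun l hl =>
    entry_cons_succ a n (hk.trans (Finset.mem_Icc.1 hl).1)

theorem tailSum_one {ν : ℕ} (n : Fin ν → ℕ) : tailSum n 1 = ∑ l, n l := by
  rw [tailSum, sum_Icc_one, Finset.sum_range]
  refine Finset.sum_congr rfl fun l _ => ?_
  rw [entry, dif_pos (by omega)]
  rfl

theorem sumTails_cons_succ {ν : ℕ} (a : ℕ) (n : Fin ν → ℕ) (j : ℕ) :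
    sumTails (Fin.cons a n : Fin (ν + 1) → ℕ) (j + 1) = a + ∑ l, n l + sumTails n j := by
  rw [sumTails, sum_Icc_one_succ, tailSum_one, Fin.sum_cons, sumTails]
  congr 1
  exact Finset.sum_congr rfl fun k hk => tailSum_cons_succ a n (Finset.mem_Icc.1 hk).1

/-- The part of the summand that depends on `m` and `n`, with `q = s ^ 2`. -/
noncomputable def core {ν : ℕ} (s : ℂ) (i : ℤ) (m : ℕ) (n : Fin ν → ℕ) : ℂ :=
  if (2 : ℤ) ∣ i - sumTails n ν - m then
    s ^ (m ^ 2) * (s ^ 3) ^ (∑ k ∈ Finset.Icc 1 ν, tailSum n k ^ 2)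
      * qBinom (s ^ 2) (3 * entry n ν) m
      * qBinom ((s ^ 3) ^ 2) (2 * entry n ν + (i - sumTails n ν - m) / 2) (2 * entry n ν)
      * ∏ j ∈ Finset.Icc 1 (ν - 1), qBinom ((s ^ 3) ^ 2) (i - sumTails n j + entry n j) (entry n j)
  else 0

/-- Every factor not displayed depends on N_1 only through i - N_1. So deleting n_1 reproduces the
same expression with i - N_1, possibly negative, in place of i. -/
theorem core_cons {ν : ℕ} (hν : 1 ≤ ν) (s : ℂ) (i : ℤ) (m a : ℕ) (n : Fin ν → ℕ) :
    core s i m (Fin.cons a n : Fin (ν + 1) → ℕ) =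
      (s ^ 3) ^ ((a + ∑ l, n l) ^ 2) *
        qBinom ((s ^ 3) ^ 2) (i - (a + ∑ l, n l : ℕ) + a) a *
          core s (i - (a + ∑ l, n l : ℕ)) m n := by
  obtain ⟨ν, rfl⟩ := Nat.exists_eq_add_of_le' hν
  unfold core
  rw [sumTails_cons_succ, Nat.cast_add, ← sub_sub, mul_ite, mul_zero]
  congr 1
  rw [Nat.add_sub_cancel, Nat.add_sub_cancel, prod_Icc_one_succ, sum_Icc_one_succ,
    entry_cons_succ a n hν, entry_cons_one, tailSum_one, Fin.sum_cons]
  have h0 : sumTails (Fin.cons a n : Fin (ν + 1 + 1) → ℕ) 1 = a + ∑ l, n l := by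
    simpa [sumTails] using sumTails_cons_succ a n 0
  have h1 : ∑ k ∈ Finset.Icc 1 (ν + 1),
      tailSum (Fin.cons a n : Fin (ν + 1 + 1) → ℕ) (k + 1) ^ 2
      = ∑ k ∈ Finset.Icc 1 (ν + 1), tailSum n k ^ 2 :=
    Finset.sum_congr rfl fun k hk => by rw [tailSum_cons_succ a n (Finset.mem_Icc.1 hk).1]
  have h2 : ∏ j ∈ Finset.Icc 1 ν, qBinom ((s ^ 3) ^ 2)
        (i - sumTails (Fin.cons a n : Fin (ν + 1 + 1) → ℕ) (j + 1)
          + entry (Fin.cons a n : Fin (ν + 1 + 1) → ℕ) (j + 1))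
        (entry (Fin.cons a n : Fin (ν + 1 + 1) → ℕ) (j + 1))
      = ∏ j ∈ Finset.Icc 1 ν, qBinom ((s ^ 3) ^ 2)
        (i - (a + ∑ l, n l : ℕ) - sumTails n j + entry n j) (entry n j) :=
    Finset.prod_congr rfl fun k hk => by
      rw [entry_cons_succ a n (Finset.mem_Icc.1 hk).1, sumTails_cons_succ, Nat.cast_add, ← sub_sub]
  rw [h0, h1, h2, pow_add]
  ring

theorem core_single (s : ℂ) (i : ℤ) (m M : ℕ) :
    core s i m ![M] = if (2 : ℤ) ∣ i - M - m then
      s ^ (m ^ 2) * (s ^ 3) ^ (M ^ 2) * qBinom (s ^ 2) (3 * M : ℕ) m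
        * qBinom ((s ^ 3) ^ 2) (2 * M + (i - M - m) / 2) (2 * M) else 0 := by
  have h1 : entry ![M] 1 = M := entry_cons_one M _
  have h2 : tailSum ![M] 1 = M := by simp [tailSum_one]
  have h3 : sumTails ![M] 1 = M := by simp [sumTails, h2]
  unfold core
  simp [h1, h2, h3]

theorem sum_antidiagonalTuple_succ {A : Type*} [AddCommMonoid A] (ν M : ℕ)
    (f : (Fin (ν + 1) → ℕ) → A) :
    ∑ n ∈ Finset.Nat.antidiagonalTuple (ν + 1) M, f n =
      ∑ u ∈ antidiagonal M, ∑ n ∈ Finset.Nat.antidiagonalTuple ν u.2, f (Fin.cons u.1 n) := by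
  rw [Finset.sum_sigma']
  refine Finset.sum_bij' (fun n _ => ⟨(n 0, ∑ l, Fin.tail n l), Fin.tail n⟩)
    (fun x _ => Fin.cons x.1.1 x.2) ?_ ?_ ?_ ?_ ?_
  · intro n hn
    rw [Finset.Nat.mem_antidiagonalTuple, Fin.sum_univ_succ] at hn
    simpa [Finset.Nat.mem_antidiagonalTuple, Fin.tail] using hn
  · rintro ⟨⟨a, b⟩, n⟩ h
    simp [Finset.Nat.mem_antidiagonalTuple] at h
    simp [Finset.Nat.mem_antidiagonalTuple, Fin.sum_cons, h.1, h.2]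
  · intro n _
    simp
  · rintro ⟨⟨a, b⟩, n⟩ h
    simp [Finset.Nat.mem_antidiagonalTuple] at h
    simp [h.2]
  · intro n _
    simp

theorem sum_core_single {s : ℂ} (hs : ‖s‖ < 1) (i : ℤ) {M K R : ℕ} (hM : M ≤ K) (hR : 3 * M < R) :
    ∑ m ∈ Finset.range R, core s i m ![M] =
      (s ^ 3) ^ (M ^ 2) * ∑ j ∈ Finset.Icc (-K : ℤ) K,
        wt s j * tau (s ^ 3) (i - M) M |j| j.natAbs := by
  have hq : ‖s ^ 2‖ < 1 := by rw [norm_pow]; exact pow_lt_one₀ (norm_nonneg s) hs two_ne_zero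
  have hp : ‖(s ^ 3) ^ 2‖ < 1 := by
    rw [← pow_mul, norm_pow]; exact pow_lt_one₀ (norm_nonneg s) hs (by norm_num)
  rcases lt_or_ge (i - M) 0 with h | h
  · rw [Finset.sum_eq_zero, Finset.sum_eq_zero, mul_zero]
    · intro j _
      rw [tau_of_neg _ _ _ _ h, mul_zero]
    · intro m _
      rw [core_single]
      split_ifs with hd
      · rw [qBinom_of_lt ((s ^ 3) ^ 2) (by omega), mul_zero]
      · rfl
  obtain ⟨L, hL⟩ := Int.eq_ofNat_of_zero_le h
  rw [hL, ← sum_wt_mul_tau hp L M K hM, Finset.Nat.sum_antidiagonal_eq_sum_range_succ_mk,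
    Finset.mul_sum]
  have e1 : ∑ m ∈ Finset.range R, core s i m ![M] =
      ∑ m ∈ Finset.range (R + L + 1), core s i m ![M] := by
    refine Finset.sum_subset (fun x => by simp; omega) fun m _ hm => ?_
    rw [core_single]
    split_ifs
    · rw [qBinom_of_lt (s ^ 2) (by simp at hm ⊢; omega)]; ring
    · rfl
  rw [e1]
  symm
  apply Finset.sum_subset_zero_on_sdiff
  · intro x; simp; omega
  · intro m hm
    simp at hm
    rw [core_single]
    split_ifs with hd
    · rw [qBinom_of_lt ((s ^ 3) ^ 2) (by omega), mul_zero]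
    · rfl
  · intro m hm
    simp at hm
    rw [core_single, hL]
    by_cases hd : Even (L - m)
    · obtain ⟨r, hr⟩ := hd
      rw [if_pos (by exact ⟨r, hr⟩), if_pos ⟨r, by omega⟩, qBinom_natCast hq,
        show (2 * (M : ℤ) + ((L : ℤ) - m) / 2) = (2 * M + r : ℕ) by omega,
        show (2 * (M : ℤ)) = (2 * M : ℕ) by simp, qBinom_natCast hp, gauss_symm hp,
        show (L - m) / 2 = r by omega]
      ring
    · rw [if_neg hd, if_neg]
      · ring
      · rintro ⟨r, hr⟩
        exact hd ⟨r.toNat, by omega⟩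

/-- Induction on the number of entries, with the seed as base. For N_1 = M and L = i - M, the sum
over N_2 is a `tauSum`; `tauSum_eq` evaluates it, adding |j| to a and j² to the exponent of s³. -/
theorem sum_core {s : ℂ} (hs : ‖s‖ < 1) (ν : ℕ) : ∀ (i : ℤ) (M K R : ℕ), M ≤ K → 3 * M < R →
    ∑ n ∈ Finset.Nat.antidiagonalTuple (ν + 1) M, ∑ m ∈ Finset.range R, core s i m n =
      (s ^ 3) ^ (M ^ 2) * ∑ j ∈ Finset.Icc (-K : ℤ) K,
        wt s j * (s ^ 3) ^ (ν * j.natAbs ^ 2) *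
          tau (s ^ 3) (i - M) M ((ν + 1) * |j|) j.natAbs := by
  have hp : ‖(s ^ 3) ^ 2‖ < 1 := by
    rw [← pow_mul, norm_pow]; exact pow_lt_one₀ (norm_nonneg s) hs (by norm_num)
  induction ν with
  | zero =>
    intro i M K R hM hR
    simpa using sum_core_single hs i hM hR
  | succ ν ih =>
    intro i M K R hM hR
    have e1 : ∀ u ∈ antidiagonal M, ∑ n ∈ Finset.Nat.antidiagonalTuple (ν + 1) u.2,
        ∑ m ∈ Finset.range R, core s i m (Fin.cons u.1 n : Fin (ν + 1 + 1) → ℕ)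
        = (s ^ 3) ^ (M ^ 2) * (qBinom ((s ^ 3) ^ 2) (i - M + u.1) u.1 *
          ((s ^ 3) ^ (u.2 ^ 2) * ∑ j ∈ Finset.Icc (-K : ℤ) K,
            wt s j * (s ^ 3) ^ (ν * j.natAbs ^ 2) *
              tau (s ^ 3) (i - M - u.2) u.2 ((ν + 1) * |j|) j.natAbs)) := by
      intro u hu
      have hu' := mem_antidiagonal.1 hu
      rw [← ih (i - M) u.2 K R (by omega) (by omega), Finset.mul_sum, Finset.mul_sum]
      refine Finset.sum_congr rfl fun n hn => ?_
      rw [Finset.Nat.mem_antidiagonalTuple] at hn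
      rw [Finset.mul_sum, Finset.mul_sum]
      refine Finset.sum_congr rfl fun m _ => ?_
      rw [core_cons (by omega), hn, hu', mul_assoc]
    rw [sum_antidiagonalTuple_succ, Finset.sum_congr rfl e1, ← Finset.mul_sum]
    congr 1
    rcases lt_or_ge (i - M) 0 with h | h
    · rw [Finset.sum_eq_zero, Finset.sum_eq_zero]
      · intro j _
        rw [tau_of_neg _ _ _ _ h, mul_zero]
      · intro m _
        rw [qBinom_of_lt _ (by omega), zero_mul]
    obtain ⟨L, hL⟩ := Int.eq_ofNat_of_zero_le h
    rw [hL]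
    simp only [Finset.mul_sum]
    rw [Finset.sum_comm]
    refine Finset.sum_congr rfl fun j _ => ?_
    -- The range bound L + 1 + M is at least L + 1, as `tauSum_eq` requires, and reaches all indices
    -- up to M; beyond M the factor `gamz` is zero.
    have key := tauSum_eq hp j.natAbs (L + 1) (L + 1 + M) M ((ν + 1) * |j|) (by omega)
      (fun _ => by positivity)
    rw [show ((L + 1 : ℕ) : ℤ) - 1 = L by push_cast; ring,
      show ((ν : ℤ) + 1) * |j| + j.natAbs = ((ν + 1 : ℕ) + 1) * |j| by
        rw [Int.natCast_natAbs]; push_cast; ring] at key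
    have e2 : tauSum (s ^ 3) (L + 1 + M) (L + 1) M ((ν + 1) * |j|) j.natAbs =
        ∑ u ∈ antidiagonal M, qBinom ((s ^ 3) ^ 2) (L + u.1 : ℕ) u.1 * (s ^ 3) ^ (u.2 ^ 2) *
          tau (s ^ 3) (L - u.2) u.2 ((ν + 1) * |j|) j.natAbs := by
      rw [← Finset.Nat.sum_antidiagonal_swap, Finset.Nat.sum_antidiagonal_eq_sum_range_succ_mk,
        tauSum]
      symm
      apply Finset.sum_subset_zero_on_sdiff
      · intro x; simp; omega
      · intro m hm
        simp at hm
        rw [gamz_of_neg _ _ (by omega)]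
        ring
      · intro m hm
        simp at hm
        simp only [Prod.fst_swap, Prod.snd_swap]
        rw [qBinom_natCast hp, show (M : ℤ) - m = (M - m : ℕ) by omega, gamz_natCast, gam,
          show ((L + 1 : ℕ) : ℤ) - 1 - m = L - m by push_cast; ring]
        ring
    rw [show (ν + 1) * j.natAbs ^ 2 = ν * j.natAbs ^ 2 + j.natAbs ^ 2 by ring, pow_add,
      show wt s j * ((s ^ 3) ^ (ν * j.natAbs ^ 2) * (s ^ 3) ^ (j.natAbs ^ 2)) *
        tau (s ^ 3) L M (((ν + 1 : ℕ) + 1) * |j|) j.natAbs = wt s j * (s ^ 3) ^ (ν * j.natAbs ^ 2) *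
        ((s ^ 3) ^ (j.natAbs ^ 2) * tau (s ^ 3) L M (((ν + 1 : ℕ) + 1) * |j|) j.natAbs) by ring,
      ← key, e2, Finset.mul_sum]
    refine Finset.sum_congr rfl fun u _ => ?_
    push_cast
    ring

/-! ### Uniform bounds and limits -/

theorem qPochInf_self_ne_zero {p : ℂ} (hp : ‖p‖ < 1) : qPochInf p p ≠ 0 := by
  have h := tprod_one_add_ne_zero_of_summable (f := fun k : ℕ => -(p * p ^ k)) ?_ ?_
  · simpa only [qPochInf, sub_eq_add_neg] using h
  · intro k
    rw [← sub_eq_add_neg, ← pow_succ']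
    exact one_sub_pow_succ_ne_zero hp k
  · simp only [norm_neg, norm_mul, norm_pow]
    exact (summable_geometric_of_lt_one (norm_nonneg p) hp).mul_left _

/-- (p; p)_n converges to a nonzero limit, so it and its reciprocal are bounded, and with them all
Gaussian binomials. This constant supplies the majorants for the dominated convergence and
summability arguments below. -/
theorem exists_norm_inv_qPoch_le {p : ℂ} (hp : ‖p‖ < 1) :
    ∃ K : ℝ, 1 ≤ K ∧ (∀ n, ‖(qPoch p p n)⁻¹‖ ≤ K) ∧ ∀ n k, ‖gauss p n k‖ ≤ K := by
  obtain ⟨A, hA⟩ := (Metric.isBounded_range_of_tendsto _ (tendsto_qPoch p p hp)).exists_norm_le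
  obtain ⟨B, hB⟩ := (Metric.isBounded_range_of_tendsto _
    ((tendsto_qPoch p p hp).inv₀ (qPochInf_self_ne_zero hp))).exists_norm_le
  have hA' : ∀ n, ‖qPoch p p n‖ ≤ A := fun n => hA _ ⟨n, rfl⟩
  have hB' : ∀ n, ‖(qPoch p p n)⁻¹‖ ≤ B := fun n => hB _ ⟨n, rfl⟩
  have hA0 : 0 ≤ A := (norm_nonneg _).trans (hA' 0)
  have hB0 : 0 ≤ B := (norm_nonneg _).trans (hB' 0)
  have h0 : 0 ≤ A * (B * B) := by positivity
  refine ⟨1 + B + A * (B * B), by linarith, fun n => by linarith [hB' n], fun n k => ?_⟩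
  rcases lt_or_ge n k with h | h
  · rw [gauss_of_lt p h, norm_zero]; linarith
  · obtain ⟨d, rfl⟩ := Nat.exists_eq_add_of_le h
    rw [gauss_eq_div hp, div_eq_mul_inv, mul_inv, norm_mul, norm_mul]
    have : ‖qPoch p p (k + d)‖ * (‖(qPoch p p k)⁻¹‖ * ‖(qPoch p p d)⁻¹‖) ≤ A * (B * B) := by
      gcongr
      exacts [hA' _, hB' _, hB' _]
    linarith

theorem tendsto_gauss_add_right {p : ℂ} (hp : ‖p‖ < 1) (n : ℕ) :
    Tendsto (fun r => gauss p (n + r) r) atTop (𝓝 (qPoch p p n)⁻¹) := by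
  have h1 := tendsto_qPoch p p hp
  have h0 := qPochInf_self_ne_zero hp
  have h2 : Tendsto (fun r => qPoch p p (n + r)) atTop (𝓝 (qPochInf p p)) := by
    simpa only [add_comm n] using (tendsto_add_atTop_iff_nat n).2 h1
  have h3 := (h2.div h1 h0).div_const (qPoch p p n)
  rw [div_self h0, one_div] at h3
  refine h3.congr fun r => ?_
  rw [add_comm n r, gauss_eq_div hp]
  simp only [Pi.div_apply]
  rw [div_div, add_comm n r]

theorem tendsto_gauss {p : ℂ} (hp : ‖p‖ < 1) (k : ℕ) :
    Tendsto (fun n => gauss p n k) atTop (𝓝 (qPoch p p k)⁻¹) := by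
  rw [← tendsto_add_atTop_iff_nat k]
  refine (tendsto_gauss_add_right hp k).congr fun r => ?_
  rw [add_comm r k, gauss_symm hp]

theorem sum_antidiagonal_mul_sum_antidiagonal (L a : ℕ) (F : ℕ → ℂ) (H : ℕ → ℕ → ℂ) :
    ∑ u ∈ antidiagonal L, F u.1 * ∑ v ∈ antidiagonal u.2,
        (if v.2 = v.1 + a then H v.1 v.2 else 0)
      = ∑ n ∈ Finset.range (L + 1), ∑ r ∈ Finset.range (L + 1),
        if n + 2 * r + a = L then F n * H r (r + a) else 0 := by
  rw [Finset.Nat.sum_antidiagonal_eq_sum_range_succ_mk]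
  refine Finset.sum_congr rfl fun n hn => ?_
  have hn' := Finset.mem_range.1 hn
  rw [Finset.Nat.sum_antidiagonal_eq_sum_range_succ_mk, Finset.mul_sum]
  apply Finset.sum_subset_zero_on_sdiff
  · intro x; simp; omega
  · intro r hr
    simp at hr
    rw [if_neg (by omega)]
  · intro r hr
    simp at hr
    by_cases h : n + 2 * r + a = L
    · rw [if_pos h, if_pos (by omega), show L - n - r = r + a by omega]
    · rw [if_neg h, if_neg (by omega), mul_zero]

/-- The limit of `tau σ L M a b` for `M → ∞`. -/
noncomputable def tauInf (σ : ℂ) (L a : ℕ) : ℂ :=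
  ∑ n ∈ Finset.range (L + 1), ∑ r ∈ Finset.range (L + 1),
    if n + 2 * r + a = L then σ ^ (n ^ 2) * (qPoch (σ ^ 2) (σ ^ 2) n)⁻¹ *
      ((qPoch (σ ^ 2) (σ ^ 2) r)⁻¹ * (qPoch (σ ^ 2) (σ ^ 2) (r + a))⁻¹) else 0

theorem tendsto_tau {σ : ℂ} (hσ : ‖σ ^ 2‖ < 1) (L a b : ℕ) :
    Tendsto (fun M : ℕ => tau σ L M a b) atTop (𝓝 (tauInf σ L a)) := by
  rw [← tendsto_add_atTop_iff_nat b]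
  have h : ∀ r : ℕ, tau σ L (r + b : ℕ) a b = ∑ n ∈ Finset.range (L + 1),
      ∑ k ∈ Finset.range (L + 1), if n + 2 * k + a = L then
        σ ^ (n ^ 2) * gauss (σ ^ 2) (r + b) n *
          (gauss (σ ^ 2) (r + (2 * b + k)) k * gauss (σ ^ 2) (r + (k + a)) (k + a)) else 0 := by
    intro r
    rw [tau_natCast _ _ _ _ _ (by omega),
      sum_antidiagonal_mul_sum_antidiagonal L a (fun n => σ ^ (n ^ 2) * gauss (σ ^ 2) (r + b) n)
      (fun k e => gam (σ ^ 2) (r + b + b + 1) k * gam (σ ^ 2) (r + b - b + 1) e)]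
    simp only [gam, Nat.add_sub_cancel]
    simp only [show ∀ k, r + b + b + k = r + (2 * b + k) by intro k; ring]
  simp only [h]
  refine tendsto_finsetSum _ fun n _ => tendsto_finsetSum _ fun k _ => ?_
  split_ifs
  · refine ((tendsto_add_atTop_iff_nat b).2 (tendsto_gauss hσ n)).const_mul _ |>.mul ?_
    exact ((tendsto_add_atTop_iff_nat (2 * b + k)).2 (tendsto_gauss hσ k)).mul
      ((tendsto_add_atTop_iff_nat (k + a)).2 (tendsto_gauss hσ (k + a)))
  · exact tendsto_const_nhds

/-- The limit M → ∞ of `tauSum_eq` at L = i: the weight [i+M-m; M-m] tends to 1/(σ²; σ²)_i. -/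
theorem sum_tau_eq_tauInf {σ : ℂ} (hσ : ‖σ ^ 2‖ < 1) (i a b : ℕ) :
    ∑ M ∈ Finset.range (i + 1), σ ^ (M ^ 2) * (qPoch (σ ^ 2) (σ ^ 2) i)⁻¹ * tau σ ((i : ℤ) -
        M) M a b
      = σ ^ (b ^ 2) * tauInf σ i (a + b) := by
  have h1 := (tendsto_tau hσ i (a + b) b).const_mul (σ ^ (b ^ 2))
  refine tendsto_nhds_unique ?_ h1
  have h2 : ∀ M : ℕ, σ ^ (b ^ 2) * tau σ i M (a + b : ℕ) b =
      ∑ m ∈ Finset.range (i + 1), σ ^ (m ^ 2) * gamz (σ ^ 2) (i + 1) ((M : ℤ) - m) *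
        tau σ ((i : ℤ) - m) m a b := by
    intro M
    have := tauSum_eq hσ b (i + 1) (i + 1) M a le_rfl (by simp)
    rw [show ((i + 1 : ℕ) : ℤ) - 1 = i by push_cast; ring] at this
    push_cast
    rw [← this, tauSum]
    refine Finset.sum_congr rfl fun m _ => ?_
    congr 2
    push_cast
    ring
  simp only [h2]
  refine tendsto_finsetSum _ fun m _ => Tendsto.mul_const _ (Tendsto.const_mul _ ?_)
  rw [← tendsto_add_atTop_iff_nat m]
  refine (tendsto_gauss_add_right hσ i).congr fun r => ?_
  rw [show ((r + m : ℕ) : ℤ) - m = r by push_cast; ring, gamz_natCast, gam]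

/-! ### Durfee rectangles, Euler's series and Jacobi's triple product -/

/-- The limit N → ∞ of the q-Vandermonde expansion of [N+t; t+a]. -/
theorem sum_antidiagonal_durfee {p : ℂ} (hp : ‖p‖ < 1) (t a : ℕ) :
    ∑ u ∈ antidiagonal t, p ^ (u.2 * (u.2 + a)) * gauss p t u.2 * (qPoch p p (u.2 + a))⁻¹
      = (qPoch p p (t + a))⁻¹ := by
  have h : ∀ N : ℕ, gauss p (N + t) (t + a) =
      ∑ u ∈ antidiagonal t, p ^ (u.2 * (u.2 + a)) * gauss p t u.2 * gauss p N (u.2 + a) := by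
    intro N
    rw [gauss_add]
    symm
    refine Finset.sum_bij_ne_zero (fun u _ _ => (u.2 + a, u.1)) ?_ ?_ ?_ ?_
    · intro u hu _
      simp at hu ⊢
      omega
    · intro u _ _ v _ _ h
      simp at h
      exact Prod.ext h.2 h.1
    · intro v hv h0
      have hv' := mem_antidiagonal.1 hv
      have h1 : v.2 ≤ t := by
        by_contra h
        exact h0 (by rw [gauss_of_lt p (not_le.1 h), mul_zero])
      have h2 : t - v.2 + a = v.1 := by omega
      refine ⟨(v.2, t - v.2), by simp; omega, ?_, ?_⟩
      · intro h3
        apply h0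
        have h4 := gauss_symm hp v.2 (t - v.2)
        rw [show v.2 + (t - v.2) = t by omega] at h4
        rw [h4, ← h2]
        simp only at h3
        linear_combination h3
      · simp [h2]
    · intro u hu _
      have hu' := mem_antidiagonal.1 hu
      have h4 := gauss_symm hp u.1 u.2
      rw [hu'] at h4
      rw [h4, show t - u.1 = u.2 by omega]
      ring
  have h1 : Tendsto (fun N => gauss p (N + t) (t + a)) atTop (𝓝 (qPoch p p (t + a))⁻¹) :=
    (tendsto_add_atTop_iff_nat t).2 (tendsto_gauss hp (t + a))
  refine tendsto_nhds_unique ?_ h1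
  simp only [h]
  exact tendsto_finsetSum _ fun u _ => (tendsto_gauss hp _).const_mul _

/-- The limit t → ∞ of `sum_antidiagonal_durfee`, by dominated convergence. -/
theorem hasSum_durfee {p : ℂ} (hp : ‖p‖ < 1) (a : ℕ) :
    HasSum (fun t : ℕ => p ^ (t * (t + a)) * (qPoch p p t)⁻¹ * (qPoch p p (t + a))⁻¹)
      (qPochInf p p)⁻¹ := by
  obtain ⟨K, hK1, hK, hG⟩ := exists_norm_inv_qPoch_le hp
  have hb : ∀ t : ℕ, ∀ c : ℂ, ‖c‖ ≤ K → ‖p ^ (t * (t + a)) * c * (qPoch p p (t + a))⁻¹‖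
      ≤ ‖p‖ ^ t * K * K := by
    intro t c hc
    rw [norm_mul, norm_mul, norm_pow]
    gcongr ?_ * ?_ * ?_
    · apply pow_le_pow_of_le_one (norm_nonneg p) hp.le
      rcases t with _ | t
      · simp
      · exact Nat.le_mul_of_pos_right _ (by omega)
    · exact hK _
  have hs : Summable fun t : ℕ => ‖p‖ ^ t * K * K :=
    ((summable_geometric_of_lt_one (norm_nonneg p) hp).mul_right _).mul_right _
  have h1 := tendsto_tsum_of_dominated_convergence (𝓕 := atTop)
    (f := fun T t : ℕ => p ^ (t * (t + a)) * gauss p T t * (qPoch p p (t + a))⁻¹)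
    (g := fun t : ℕ => p ^ (t * (t + a)) * (qPoch p p t)⁻¹ * (qPoch p p (t + a))⁻¹) hs
    (fun t => ((tendsto_gauss hp t).const_mul _).mul_const _)
    (Eventually.of_forall fun T t => hb t _ (hG T t))
  have h2 : ∀ T : ℕ, ∑' t : ℕ, p ^ (t * (t + a)) * gauss p T t * (qPoch p p (t + a))⁻¹
      = (qPoch p p (T + a))⁻¹ := by
    intro T
    rw [← sum_antidiagonal_durfee hp T a, tsum_eq_sum (s := Finset.range (T + 1))]
    · rw [← Finset.Nat.sum_antidiagonal_swap, Finset.Nat.sum_antidiagonal_eq_sum_range_succ_mk]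
      rfl
    · intro t ht
      rw [gauss_of_lt p (by simpa using ht)]
      ring
  simp only [h2] at h1
  have h3 := ((tendsto_add_atTop_iff_nat a).2 (tendsto_qPoch p p hp)).inv₀
    (qPochInf_self_ne_zero hp)
  rw [← tendsto_nhds_unique h1 h3]
  exact (hs.of_norm_bounded fun t => hb t _ (hK t)).hasSum

/-- The finite `q`-binomial theorem. -/
theorem sum_gauss_eq_qPoch (p α : ℂ) (n : ℕ) :
    ∑ r ∈ Finset.range (n + 1), α ^ r * p ^ (r.choose 2) * gauss p n r = qPoch (-α) p n := by
  induction n with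
  | zero => simp [qPoch_zero]
  | succ n ih =>
    rw [qPoch_succ, ← ih, Finset.sum_range_succ']
    have h1 : ∀ r ∈ Finset.range (n + 1),
        α ^ (r + 1) * p ^ ((r + 1).choose 2) * gauss p (n + 1) (r + 1)
        = α * p ^ n * (α ^ r * p ^ (r.choose 2) * gauss p n r)
          + α ^ (r + 1) * p ^ ((r + 1).choose 2) * gauss p n (r + 1) := by
      intro r hr
      obtain ⟨d, rfl⟩ := Nat.exists_eq_add_of_le (Nat.lt_succ_iff.1 (Finset.mem_range.1 hr))
      rw [gauss_succ_succ, Nat.choose_succ_succ' r 1, Nat.choose_one_right,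
        Nat.add_sub_cancel_left]
      ring
    have h2 := Finset.sum_range_succ' (fun r => α ^ r * p ^ (r.choose 2) * gauss p n r) (n + 1)
    rw [Finset.sum_range_succ, gauss_of_lt p (Nat.lt_succ_self n)] at h2
    simp only [gauss_zero_right] at h2 ⊢
    rw [Finset.sum_congr rfl h1, Finset.sum_add_distrib, ← Finset.mul_sum]
    linear_combination -h2

theorem norm_euler_le {p α : ℂ} (hp : ‖p‖ < 1) {K : ℝ} (r : ℕ) {c : ℂ} (hc : ‖c‖ ≤ K) :
    ‖α ^ r * p ^ (r.choose 2) * c‖ ≤ ‖α‖ ^ r * K := by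
  rw [norm_mul, norm_mul, norm_pow, norm_pow]
  have h1 : ‖p‖ ^ r.choose 2 ≤ 1 := pow_le_one₀ (norm_nonneg p) hp.le
  have h2 : ‖α‖ ^ r * ‖p‖ ^ r.choose 2 ≤ ‖α‖ ^ r :=
    mul_le_of_le_one_right (by positivity) h1
  gcongr

theorem summable_euler {p α : ℂ} (hp : ‖p‖ < 1) (hα : ‖α‖ < 1) :
    Summable fun r : ℕ => ‖α ^ r * p ^ (r.choose 2) * (qPoch p p r)⁻¹‖ := by
  obtain ⟨K, -, hK, -⟩ := exists_norm_inv_qPoch_le hp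
  exact Summable.of_nonneg_of_le (fun _ => norm_nonneg _) (fun r => norm_euler_le hp r (hK r))
    ((summable_geometric_of_lt_one (norm_nonneg α) hα).mul_right K)

/-- The limit n → ∞ of the finite q-binomial theorem, again by dominated convergence. -/
theorem hasSum_euler {p α : ℂ} (hp : ‖p‖ < 1) (hα : ‖α‖ < 1) :
    HasSum (fun r : ℕ => α ^ r * p ^ (r.choose 2) * (qPoch p p r)⁻¹) (qPochInf (-α) p) := by
  obtain ⟨K, -, hK, hG⟩ := exists_norm_inv_qPoch_le hp
  have h1 := tendsto_tsum_of_dominated_convergence (𝓕 := atTop)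
    (f := fun n r : ℕ => α ^ r * p ^ (r.choose 2) * gauss p n r)
    (g := fun r : ℕ => α ^ r * p ^ (r.choose 2) * (qPoch p p r)⁻¹)
    ((summable_geometric_of_lt_one (norm_nonneg α) hα).mul_right K)
    (fun r => (tendsto_gauss hp r).const_mul _)
    (Eventually.of_forall fun n r => norm_euler_le hp r (hG n r))
  have h2 : ∀ n : ℕ, ∑' r : ℕ, α ^ r * p ^ (r.choose 2) * gauss p n r = qPoch (-α) p n := by
    intro n
    rw [← sum_gauss_eq_qPoch, tsum_eq_sum]
    intro r hr
    rw [gauss_of_lt p (by simpa using hr), mul_zero]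
  simp only [h2] at h1
  rw [← tendsto_nhds_unique h1 (tendsto_qPoch _ p hp)]
  exact (summable_euler hp hα).of_norm.hasSum

/-- The general term of the theta series. -/
noncomputable def theta (p α β : ℂ) (j : ℤ) : ℂ :=
  α ^ j.toNat * β ^ (-j).toNat * p ^ (j.natAbs.choose 2)

/-- The exponent count for Jacobi's identity: the summand t comes from (αβ)^t = p^t, and t(t+a) is
the size of a Durfee rectangle. -/
theorem choose_two_add (t a : ℕ) :
    (t + a).choose 2 + t.choose 2 + t = a.choose 2 + t * (t + a) := by
  induction t with
  | zero => simp
  | succ t ih =>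
    rw [show t + 1 + a = t + a + 1 by ring, Nat.choose_succ_succ' _ 1, Nat.choose_succ_succ' _ 1,
      Nat.choose_one_right, Nat.choose_one_right]
    linarith

/-- Pairs of natural numbers with given difference. -/
def diffEquiv (j : ℤ) : ℕ ≃ {x : ℕ × ℕ // (x.1 : ℤ) - x.2 = j} where
  toFun t := ⟨(t + j.toNat, t + (-j).toNat), by push_cast; omega⟩
  invFun x := min x.1.1 x.1.2
  left_inv t := by simp; omega
  right_inv := by
    rintro ⟨⟨a, b⟩, h⟩
    simp only [Subtype.mk.injEq, Prod.mk.injEq]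
    simp only at h
    omega

theorem hasSum_of_hasSum_diff {f : ℕ × ℕ → ℂ} {S : ℂ} {g : ℤ → ℂ} (hf : HasSum f S)
    (hg : ∀ j : ℤ, HasSum (fun t : ℕ => f (t + j.toNat, t + (-j).toNat)) (g j)) : HasSum g S := by
  rw [← (Equiv.sigmaFiberEquiv fun x : ℕ × ℕ => (x.1 : ℤ) - x.2).hasSum_iff] at hf
  refine hf.sigma fun j => ?_
  rw [← (diffEquiv j).hasSum_iff]
  exact hg j

theorem hasSum_mul_of_summable_norm {f g : ℕ → ℂ} {a b : ℂ} (hf : HasSum f a) (hg : HasSum g b)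
    (hf' : Summable fun n => ‖f n‖) (hg' : Summable fun n => ‖g n‖) :
    HasSum (fun x : ℕ × ℕ => f x.1 * g x.2) (a * b) :=
  hf.mul hg (summable_mul_of_summable_norm hf' hg')

/-- Jacobi's triple product identity. -/
theorem hasSum_theta {p α β : ℂ} (hp : ‖p‖ < 1) (hα : ‖α‖ < 1) (hβ : ‖β‖ < 1) (h : α * β = p) :
    HasSum (theta p α β) (qPochInf p p * qPochInf (-α) p * qPochInf (-β) p) := by
  -- The product of two Euler series is regrouped by the difference j of the indices. Each fibre is
  -- a Durfee sum, equal to the j-th theta term divided by (p; p)_∞.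
  have h1 := hasSum_mul_of_summable_norm (hasSum_euler hp hα) (hasSum_euler hp hβ)
    (summable_euler hp hα) (summable_euler hp hβ)
  have h2 := hasSum_of_hasSum_diff (g := fun j => theta p α β j * (qPochInf p p)⁻¹) h1 fun j => ?_
  · rw [show qPochInf p p * qPochInf (-α) p * qPochInf (-β) p
      = qPochInf (-α) p * qPochInf (-β) p * qPochInf p p by ring]
    refine (h2.mul_right (qPochInf p p)).congr_fun fun j => ?_
    rw [mul_assoc, inv_mul_cancel₀ (qPochInf_self_ne_zero hp), mul_one]
  · have h4 := (hasSum_durfee hp j.natAbs).mul_left (theta p α β j)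
    refine h4.congr_fun fun t => ?_
    have h5 := congrArg (p ^ ·) (choose_two_add t j.natAbs)
    simp only [pow_add] at h5
    have h6 : α ^ t * β ^ t = p ^ t := by rw [← mul_pow, h]
    simp only [theta]
    rcases le_total 0 j with hj | hj
    · rw [show j.toNat = j.natAbs by omega, show (-j).toNat = 0 by omega, add_zero, pow_add]
      linear_combination (α ^ j.natAbs * p ^ ((t + j.natAbs).choose 2) * p ^ (t.choose 2) *
        (qPoch p p t)⁻¹ * (qPoch p p (t + j.natAbs))⁻¹) * h6 +
        (α ^ j.natAbs * (qPoch p p t)⁻¹ * (qPoch p p (t + j.natAbs))⁻¹) * h5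
    · rw [show (-j).toNat = j.natAbs by omega, show j.toNat = 0 by omega, add_zero, pow_add]
      linear_combination (β ^ j.natAbs * p ^ ((t + j.natAbs).choose 2) * p ^ (t.choose 2) *
        (qPoch p p t)⁻¹ * (qPoch p p (t + j.natAbs))⁻¹) * h6 +
        (β ^ j.natAbs * (qPoch p p t)⁻¹ * (qPoch p p (t + j.natAbs))⁻¹) * h5

/-! ### Summation over i -/

/-- The general term of the double series for `tauInf`. -/
noncomputable def tauTerm (σ : ℂ) (a n r : ℕ) : ℂ :=
  σ ^ (n ^ 2) * (qPoch (σ ^ 2) (σ ^ 2) n)⁻¹ *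
    ((qPoch (σ ^ 2) (σ ^ 2) r)⁻¹ * (qPoch (σ ^ 2) (σ ^ 2) (r + a))⁻¹)

theorem norm_tauTerm_le {σ : ℂ} (hσ : ‖σ‖ < 1) {K : ℝ}
    (hK : ∀ n, ‖(qPoch (σ ^ 2) (σ ^ 2) n)⁻¹‖ ≤ K) (a n r : ℕ) :
    ‖σ ^ ((n + 2 * r + a) ^ 2) * tauTerm σ a n r‖ ≤ ‖σ‖ ^ n * ‖σ‖ ^ r * (K * (K * K)) := by
  have hK0 : 0 ≤ K := (norm_nonneg _).trans (hK 0)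
  rw [tauTerm, mul_assoc (σ ^ (n ^ 2)), ← mul_assoc (σ ^ _), ← pow_add, norm_mul, norm_mul,
    norm_mul, norm_pow, ← pow_add]
  gcongr ?_ * (?_ * (?_ * ?_))
  · apply pow_le_pow_of_le_one (norm_nonneg σ) hσ.le
    have : n + 2 * r + a ≤ (n + 2 * r + a) ^ 2 := Nat.le_self_pow two_ne_zero _
    omega
  exacts [hK _, hK _, hK _]

theorem norm_sq_lt_one {σ : ℂ} (hσ : ‖σ‖ < 1) : ‖σ ^ 2‖ < 1 := by
  rw [norm_pow]; exact pow_lt_one₀ (norm_nonneg σ) hσ two_ne_zero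

theorem summable_geometric_prod {x : ℝ} (h0 : 0 ≤ x) (h1 : x < 1) :
    Summable fun u : ℕ × ℕ => x ^ u.1 * x ^ u.2 :=
  (summable_geometric_of_lt_one h0 h1).mul_of_nonneg (summable_geometric_of_lt_one h0 h1)
    (fun _ => by positivity) (fun _ => by positivity)

/-- With t = n + r one has n² + (n+2r+a)² = a² + 2t(t+a) + 2r(r+a). The finite sum over r is then
`sum_antidiagonal_durfee`, and the sum over t is `hasSum_durfee`. -/
theorem hasSum_tauTerm {σ : ℂ} (hσ : ‖σ‖ < 1) (a : ℕ) :
    HasSum (fun u : ℕ × ℕ => σ ^ ((u.1 + 2 * u.2 + a) ^ 2) * tauTerm σ a u.1 u.2)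
      (σ ^ (a ^ 2) * (qPochInf (σ ^ 2) (σ ^ 2))⁻¹) := by
  have hp := norm_sq_lt_one hσ
  obtain ⟨K, -, hK, -⟩ := exists_norm_inv_qPoch_le hp
  have hs : Summable fun u : ℕ × ℕ => σ ^ ((u.1 + 2 * u.2 + a) ^ 2) * tauTerm σ a u.1 u.2 :=
    ((summable_geometric_prod (norm_nonneg σ) hσ).mul_right _).of_norm_bounded
      fun u => norm_tauTerm_le hσ hK a u.1 u.2
  have h1 := hs.hasSum
  rw [← Finset.HasAntidiagonal.sigmaAntidiagonalEquivProd.hasSum_iff] at h1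
  have h2 := h1.sigma fun t => Finset.hasSum (antidiagonal t)
    fun u : ℕ × ℕ => σ ^ ((u.1 + 2 * u.2 + a) ^ 2) * tauTerm σ a u.1 u.2
  have h3 := (hasSum_durfee hp a).mul_left (σ ^ (a ^ 2))
  have h4 := h2.unique (h3.congr_fun fun t => ?_)
  · rw [← h4]; exact hs.hasSum
  rw [← sum_antidiagonal_durfee hp t a, Finset.mul_sum, Finset.mul_sum]
  refine Finset.sum_congr rfl fun u hu => ?_
  have hu' := mem_antidiagonal.1 hu
  have h5 := gauss_eq_div hp u.2 u.1
  rw [add_comm u.2 u.1, hu'] at h5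
  have h6 := qPoch_self_ne_zero hp t
  rw [h5, tauTerm, ← hu'] at *
  rw [div_eq_mul_inv, mul_inv]
  have h7 : (qPoch (σ ^ 2) (σ ^ 2) (u.1 + u.2))⁻¹ * qPoch (σ ^ 2) (σ ^ 2) (u.1 + u.2) = 1 :=
    inv_mul_cancel₀ h6
  linear_combination (-σ ^ (a ^ 2) * (σ ^ 2) ^ ((u.1 + u.2) * (u.1 + u.2 + a)) *
    (σ ^ 2) ^ (u.2 * (u.2 + a)) * (qPoch (σ ^ 2) (σ ^ 2) u.1)⁻¹ * (qPoch (σ ^ 2) (σ ^ 2) u.2)⁻¹ *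
    (qPoch (σ ^ 2) (σ ^ 2) (u.2 + a))⁻¹) * h7

theorem summable_pow_natAbs {x : ℝ} (h0 : 0 ≤ x) (h1 : x < 1) :
    Summable fun j : ℤ => x ^ j.natAbs := by
  apply Summable.of_nat_of_neg <;> simpa using summable_geometric_of_lt_one h0 h1

theorem norm_wt_le {s : ℂ} (hs : ‖s‖ < 1) (j : ℤ) : ‖wt s j‖ ≤ ‖s‖ ^ j.natAbs := by
  rw [wt, norm_pow]
  apply pow_le_pow_of_le_one (norm_nonneg s) hs.le
  have h1 := wt_exponent_nonneg j
  zify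
  rw [Int.toNat_of_nonneg h1]
  rcases le_total 0 j with h | h
  · rw [abs_of_nonneg h]; nlinarith
  · rw [abs_of_nonpos h]; nlinarith

/-- The sum over `j` for a given value of `i`. -/
noncomputable def thetaSum (s : ℂ) (ν i : ℕ) : ℂ :=
  ∑ j ∈ Finset.Icc (-i : ℤ) i, wt s j * (s ^ 3) ^ ((ν + 1) * j.natAbs ^ 2) *
    tauInf (s ^ 3) i ((ν + 2) * j.natAbs)

/-- An absolutely convergent triple series over (j, n, r) is summed in two ways: for fixed j by
`hasSum_tauTerm`, and along the fibres of i = n + 2r + (ν+2)|j|, which are finite. -/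
theorem hasSum_thetaSum {s : ℂ} (hs : ‖s‖ < 1) (ν : ℕ) {S : ℂ}
    (hS : HasSum (fun j : ℤ => wt s j * (s ^ 3) ^ ((ν + 1) * j.natAbs ^ 2) *
      (s ^ 3) ^ (((ν + 2) * j.natAbs) ^ 2)) S) :
    HasSum (fun i : ℕ => (s ^ 3) ^ (i ^ 2) * thetaSum s ν i)
      (S * (qPochInf ((s ^ 3) ^ 2) ((s ^ 3) ^ 2))⁻¹) := by
  have hσ : ‖s ^ 3‖ < 1 := by
    rw [norm_pow]; exact pow_lt_one₀ (norm_nonneg s) hs three_ne_zero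
  obtain ⟨K, -, hK, -⟩ := exists_norm_inv_qPoch_le (norm_sq_lt_one hσ)
  set G : ℤ × ℕ × ℕ → ℂ := fun x => wt s x.1 * (s ^ 3) ^ ((ν + 1) * x.1.natAbs ^ 2) *
    ((s ^ 3) ^ ((x.2.1 + 2 * x.2.2 + (ν + 2) * x.1.natAbs) ^ 2) *
      tauTerm (s ^ 3) ((ν + 2) * x.1.natAbs) x.2.1 x.2.2) with hG
  have hsum : Summable G := by
    have h1 := ((summable_pow_natAbs (norm_nonneg s) hs).mul_of_nonneg
      (summable_geometric_prod (norm_nonneg (s ^ 3)) hσ) (fun _ => by positivity)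
      (fun _ => by positivity)).mul_right (K * (K * K))
    refine h1.of_norm_bounded fun x => ?_
    rw [hG, norm_mul, norm_mul, mul_assoc (‖s‖ ^ _)]
    refine mul_le_mul ?_ (norm_tauTerm_le hσ hK _ _ _) (norm_nonneg _) (by positivity)
    refine (mul_le_of_le_one_right (norm_nonneg _) ?_).trans (norm_wt_le hs x.1)
    rw [norm_pow]
    exact pow_le_one₀ (norm_nonneg _) hσ.le
  have h1 := hsum.hasSum.prod_fiberwise fun j => (hasSum_tauTerm hσ ((ν + 2) * j.natAbs)).mul_left
    (wt s j * (s ^ 3) ^ ((ν + 1) * j.natAbs ^ 2))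
  have h2 := h1.unique ((hS.mul_right
    (qPochInf ((s ^ 3) ^ 2) ((s ^ 3) ^ 2))⁻¹).congr_fun fun j => by ring)
  rw [← h2]
  have h3 := hsum.hasSum
  rw [← (Equiv.sigmaFiberEquiv fun x : ℤ × ℕ × ℕ =>
    x.2.1 + 2 * x.2.2 + (ν + 2) * x.1.natAbs).hasSum_iff] at h3
  refine h3.sigma fun i => ?_
  have h4 : HasSum (fun x : ℤ × ℕ × ℕ =>
      if x.2.1 + 2 * x.2.2 + (ν + 2) * x.1.natAbs = i then G x else 0)
      ((s ^ 3) ^ (i ^ 2) * thetaSum s ν i) := by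
    have h5 : (s ^ 3) ^ (i ^ 2) * thetaSum s ν i =
        ∑ x ∈ Finset.Icc (-i : ℤ) i ×ˢ (Finset.range (i + 1) ×ˢ Finset.range (i + 1)),
          if x.2.1 + 2 * x.2.2 + (ν + 2) * x.1.natAbs = i then G x else 0 := by
      rw [Finset.sum_product, thetaSum, Finset.mul_sum]
      refine Finset.sum_congr rfl fun j _ => ?_
      rw [Finset.sum_product, tauInf, Finset.mul_sum, Finset.mul_sum]
      refine Finset.sum_congr rfl fun n _ => ?_
      rw [Finset.mul_sum, Finset.mul_sum]
      refine Finset.sum_congr rfl fun r _ => ?_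
      simp only [hG, tauTerm]
      split_ifs with h
      · rw [h]; ring
      · ring
    rw [h5]
    apply hasSum_sum_of_ne_finset_zero
    rintro ⟨j, n, r⟩ h
    rw [if_neg]
    intro h6
    apply h
    have h7 : j.natAbs ≤ (ν + 2) * j.natAbs := Nat.le_mul_of_pos_left _ (by omega)
    simp only at h6
    simp only [Finset.mem_product, Finset.mem_Icc, Finset.mem_range]
    omega
  have h5 := (hasSum_subtype_iff_of_support_subset (s := {x : ℤ × ℕ × ℕ |
    x.2.1 + 2 * x.2.2 + (ν + 2) * x.1.natAbs = i}) ?_).2 h4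
  · refine h5.congr_fun fun x => ?_
    have hx := x.2
    simp only [Set.mem_ofPred_eq] at hx
    simp only [Function.comp_apply]
    rw [if_pos hx]
    rfl
  · intro x hx
    by_contra h
    exact hx (if_neg h)

/-- The coefficient of j² in the exponent of s is 3 + 3(ν+1) + 3(ν+2)² = 3(ν+2)(ν+3), six times the
binomial coefficient; the linear term 2j splits the two theta parameters by ±1 in powers of s². -/
theorem wt_mul_eq_theta (s : ℂ) (ν : ℕ) (j : ℤ) :
    wt s j * (s ^ 3) ^ ((ν + 1) * j.natAbs ^ 2) * (s ^ 3) ^ (((ν + 2) * j.natAbs) ^ 2) =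
      theta ((s ^ 2) ^ (6 * (ν + 3).choose 2)) ((s ^ 2) ^ (3 * (ν + 3).choose 2 + 1))
        ((s ^ 2) ^ (3 * (ν + 3).choose 2 - 1)) j := by
  obtain ⟨C, hC⟩ : ∃ C : ℕ, (ν + 3).choose 2 = C + 1 :=
    Nat.exists_eq_add_of_le' (Nat.choose_pos (by omega))
  have hC2 : 2 * (C + 1) = (ν + 3) * (ν + 2) := by
    rw [← hC, Nat.choose_two_right]
    exact Nat.mul_div_cancel' (Nat.even_mul_pred_self (ν + 3)).two_dvd
  rw [hC, show 3 * (C + 1) - 1 = 3 * C + 2 by omega]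
  simp only [wt, theta, ← pow_mul, ← pow_add]
  congr 1
  have h : ∀ n : ℕ, ((n.choose 2 : ℕ) : ℤ) * 2 = n * (n - 1) := by
    intro n
    induction n with
    | zero => simp
    | succ n ih => rw [Nat.choose_succ_succ' n 1]; push_cast; linarith [Nat.choose_one_right n, ih]
  have h1 := h j.natAbs
  have h2 := wt_exponent_nonneg j
  zify at hC2 ⊢
  rw [Int.toNat_of_nonneg h2]
  rw [Int.natCast_natAbs] at h1
  rcases le_total 0 j with hj | hj
  · rw [abs_of_nonneg hj] at *
    rw [Int.toNat_of_nonneg hj, Int.toNat_of_nonpos (by omega)]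
    push_cast
    linear_combination (-3 * j ^ 2) * hC2 - 6 * (C + 1) * h1
  · rw [abs_of_nonpos hj] at *
    rw [Int.toNat_of_nonneg (by omega : 0 ≤ -j), Int.toNat_of_nonpos hj]
    push_cast
    linear_combination (-3 * j ^ 2) * hC2 - 6 * (C + 1) * h1

/-! ### Absolute convergence and assembly -/

/-- The summand as a power of `s`, extended by zero to all indices. -/
noncomputable def term {ν : ℕ} (s : ℂ) (x : ℕ × ℕ × (Fin ν → ℕ)) : ℂ :=
  (s ^ 3) ^ (x.1 ^ 2) * ((qPoch ((s ^ 3) ^ 2) ((s ^ 3) ^ 2) x.1)⁻¹ * core s x.1 x.2.1 x.2.2)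

theorem sum_core_eq_thetaSum {s : ℂ} (hs : ‖s‖ < 1) (ν i : ℕ) :
    ∑ M ∈ Finset.range (i + 1), ∑ n ∈ Finset.Nat.antidiagonalTuple (ν + 1) M,
      ∑ m ∈ Finset.range (3 * i + 1),
        (qPoch ((s ^ 3) ^ 2) ((s ^ 3) ^ 2) i)⁻¹ * core s i m n = thetaSum s ν i := by
  have hσ : ‖s ^ 3‖ < 1 := by
    rw [norm_pow]; exact pow_lt_one₀ (norm_nonneg s) hs three_ne_zero
  simp only [← Finset.mul_sum]
  have h1 : ∀ M ∈ Finset.range (i + 1), ∑ n ∈ Finset.Nat.antidiagonalTuple (ν + 1) M,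
      ∑ m ∈ Finset.range (3 * i + 1), core s i m n =
      (s ^ 3) ^ (M ^ 2) * ∑ j ∈ Finset.Icc (-i : ℤ) i,
        wt s j * (s ^ 3) ^ (ν * j.natAbs ^ 2) *
          tau (s ^ 3) (i - M) M ((ν + 1) * |j|) j.natAbs := by
    intro M hM
    rw [Finset.mem_range] at hM
    exact sum_core hs ν i M i (3 * i + 1) (by omega) (by omega)
  rw [Finset.sum_congr rfl h1, thetaSum, Finset.mul_sum]
  simp only [Finset.mul_sum]
  rw [Finset.sum_comm]
  refine Finset.sum_congr rfl fun j _ => ?_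
  have h2 := sum_tau_eq_tauInf (norm_sq_lt_one hσ) i ((ν + 1) * j.natAbs) j.natAbs
  rw [show (ν + 1) * j.natAbs + j.natAbs = (ν + 2) * j.natAbs by ring] at h2
  rw [show (ν + 1) * j.natAbs ^ 2 = ν * j.natAbs ^ 2 + j.natAbs ^ 2 by ring, pow_add, mul_assoc,
    mul_assoc, ← h2, Finset.mul_sum, Finset.mul_sum]
  refine Finset.sum_congr rfl fun M _ => ?_
  push_cast
  ring

theorem tailSum_one_le_sumTails {ν : ℕ} (n : Fin (ν + 1) → ℕ) :
    tailSum n 1 ≤ sumTails n (ν + 1) :=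
  Finset.single_le_sum (f := fun k => tailSum n k) (fun _ _ => Nat.zero_le _) (by simp)

/-- N_1 is at most N_1 + ⋯ + N_ν, so in either case the half-difference is negative and the second
binomial vanishes. Thus only finitely many (m, n) occur for each i. -/
theorem core_eq_zero {ν : ℕ} (s : ℂ) (i : ℕ) (m : ℕ) (n : Fin (ν + 1) → ℕ)
    (h : i < m ∨ i < ∑ l, n l) : core s i m n = 0 := by
  have h1 := tailSum_one_le_sumTails n
  rw [tailSum_one] at h1
  rw [core]
  split_ifs with hd
  · rw [qBinom_of_lt ((s ^ 3) ^ 2) (A := 2 * entry n (ν + 1) + _) (by omega)]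
    ring
  · rfl

theorem hasSum_term_fiber {s : ℂ} (hs : ‖s‖ < 1) (ν i : ℕ) :
    HasSum (fun y : ℕ × (Fin (ν + 1) → ℕ) => term s (i, y))
      ((s ^ 3) ^ (i ^ 2) * thetaSum s ν i) := by
  classical
  have h : (s ^ 3) ^ (i ^ 2) * thetaSum s ν i =
      ∑ y ∈ Finset.range (3 * i + 1) ×ˢ
        (Finset.range (i + 1)).biUnion (Finset.Nat.antidiagonalTuple (ν + 1)),
        term s (i, y) := by
    simp only [term]
    rw [← sum_core_eq_thetaSum hs, ← Finset.mul_sum, Finset.sum_product_right,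
      Finset.sum_biUnion]
    intro a _ b _ hab
    rw [Function.onFun, Finset.disjoint_left]
    intro n ha hb
    rw [Finset.Nat.mem_antidiagonalTuple] at ha hb
    exact hab (ha.symm.trans hb)
  rw [h]
  apply hasSum_sum_of_ne_finset_zero
  rintro ⟨m, n⟩ hx
  simp only [term]
  rw [core_eq_zero, mul_zero, mul_zero]
  by_contra! hlt
  apply hx
  simp only [Finset.mem_product, Finset.mem_range, Finset.mem_biUnion,
    Finset.Nat.mem_antidiagonalTuple]
  exact ⟨by omega, _, Nat.lt_succ_of_le hlt.2, rfl⟩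

theorem summable_pow_sum {x : ℝ} (h0 : 0 ≤ x) (h1 : x < 1) (ν : ℕ) :
    Summable fun n : Fin ν → ℕ => x ^ ∑ l, n l := by
  induction ν with
  | zero => exact (hasSum_fintype _).summable
  | succ ν ih =>
    rw [← (Fin.consEquiv fun _ : Fin (ν + 1) => ℕ).summable_iff]
    refine ((summable_geometric_of_lt_one h0 h1).mul_of_nonneg ih (fun _ => by positivity)
      (fun _ => by positivity)).congr fun u => ?_
    simp [Fin.consEquiv, Fin.sum_univ_succ, pow_add]

theorem norm_qBinom_le {p : ℂ} (hp : ‖p‖ < 1) {K : ℝ} (hK1 : 1 ≤ K)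
    (hK : ∀ n k, ‖gauss p n k‖ ≤ K) (A B : ℤ) : ‖qBinom p A B‖ ≤ K := by
  by_cases h : 0 ≤ B ∧ 0 ≤ A - B
  · lift B to ℕ using h.1
    lift A to ℕ using (by omega)
    rw [qBinom_natCast hp]
    exact hK _ _
  · rw [qBinom, if_neg h, norm_zero]
    linarith

/-- A geometric majorant suffices: m² ≥ m, 3 ∑ N_k² ≥ N_1 = ∑ n_l, and each of the ν + 2 binomials
is bounded by K. -/
theorem norm_core_le {ν : ℕ} {s : ℂ} (hs : ‖s‖ < 1) {K : ℝ} (hK1 : 1 ≤ K)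
    (hK : ∀ n k, ‖gauss (s ^ 2) n k‖ ≤ K) (hK' : ∀ n k, ‖gauss ((s ^ 3) ^ 2) n k‖ ≤ K)
    (i : ℤ) (m : ℕ) (n : Fin (ν + 1) → ℕ) :
    ‖core s i m n‖ ≤ ‖s‖ ^ m * ‖s‖ ^ (∑ l, n l) * (K * (K * K ^ ν)) := by
  have hp : ‖s ^ 2‖ < 1 := norm_sq_lt_one hs
  have hσ : ‖s ^ 3‖ < 1 := by
    rw [norm_pow]; exact pow_lt_one₀ (norm_nonneg s) hs three_ne_zero
  have hK0 : 0 ≤ K := zero_le_one.trans hK1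
  rw [core]
  split_ifs
  · rw [mul_assoc, mul_assoc, norm_mul, norm_mul, norm_mul, norm_mul]
    refine mul_le_mul ?_ ?_ (by positivity) (by positivity)
    · rw [norm_pow, ← pow_mul, norm_pow]
      refine mul_le_mul (pow_le_pow_of_le_one (norm_nonneg s) hs.le (Nat.le_self_pow two_ne_zero _))
        (pow_le_pow_of_le_one (norm_nonneg s) hs.le ?_) (by positivity) (by positivity)
      have h1 : tailSum n 1 ^ 2 ≤ ∑ k ∈ Finset.Icc 1 (ν + 1), tailSum n k ^ 2 :=
        Finset.single_le_sum (f := fun k => tailSum n k ^ 2) (fun _ _ => Nat.zero_le _) (by simp)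
      have h2 : tailSum n 1 ≤ tailSum n 1 ^ 2 := Nat.le_self_pow two_ne_zero _
      rw [tailSum_one] at h1 h2
      omega
    · refine mul_le_mul (norm_qBinom_le hp hK1 hK _ _) ?_ (by positivity) hK0
      refine mul_le_mul (norm_qBinom_le (norm_sq_lt_one hσ) hK1 hK' _ _) ?_ (by positivity) hK0
      rw [norm_prod]
      refine (Finset.prod_le_prod (fun _ _ => norm_nonneg _) fun j _ =>
        norm_qBinom_le (norm_sq_lt_one hσ) hK1 hK' _ _).trans_eq ?_
      simp
  · rw [norm_zero]; positivity

theorem summable_term {s : ℂ} (hs : ‖s‖ < 1) (ν : ℕ) :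
    Summable (term s : ℕ × ℕ × (Fin (ν + 1) → ℕ) → ℂ) := by
  have hσ : ‖s ^ 3‖ < 1 := by
    rw [norm_pow]; exact pow_lt_one₀ (norm_nonneg s) hs three_ne_zero
  obtain ⟨K, hK1, -, hK⟩ := exists_norm_inv_qPoch_le (norm_sq_lt_one hs)
  obtain ⟨K', -, hK2, hK'⟩ := exists_norm_inv_qPoch_le (norm_sq_lt_one hσ)
  set T := max K K'
  have h := ((summable_geometric_of_lt_one (norm_nonneg (s ^ 3)) hσ).mul_of_nonneg
    ((summable_geometric_of_lt_one (norm_nonneg s) hs).mul_of_nonneg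
      (summable_pow_sum (norm_nonneg s) hs (ν + 1)) (fun _ => by positivity)
      (fun _ => by positivity)) (fun _ => by positivity)
      (fun _ => by positivity)).mul_right (T * (T * (T * T ^ ν)))
  refine h.of_norm_bounded fun x => ?_
  have hT0 : 0 ≤ T := zero_le_one.trans (hK1.trans (le_max_left _ _))
  have h1 := norm_core_le hs (hK1.trans (le_max_left K K'))
    (fun n k => (hK n k).trans (le_max_left _ _)) (fun n k => (hK' n k).trans (le_max_right _ _))
    (x.1 : ℤ) x.2.1 x.2.2
  rw [term, norm_mul, norm_mul, norm_pow]
  calc _ ≤ ‖s ^ 3‖ ^ x.1 * (T * (‖s‖ ^ x.2.1 * ‖s‖ ^ (∑ l, x.2.2 l) * (T * (T * T ^ ν)))) := by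
        refine mul_le_mul (pow_le_pow_of_le_one (norm_nonneg _) hσ.le
          (Nat.le_self_pow two_ne_zero _)) ?_ (by positivity) (by positivity)
        exact mul_le_mul ((hK2 _).trans (le_max_right _ _)) h1 (norm_nonneg _) hT0
    _ = _ := by ring

theorem hasSum_term {s : ℂ} (hs : ‖s‖ < 1) (ν : ℕ) {S : ℂ}
    (hS : HasSum (fun j : ℤ => wt s j * (s ^ 3) ^ ((ν + 1) * j.natAbs ^ 2) *
      (s ^ 3) ^ (((ν + 2) * j.natAbs) ^ 2)) S) :
    HasSum (term s : ℕ × ℕ × (Fin (ν + 1) → ℕ) → ℂ)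
      (S * (qPochInf ((s ^ 3) ^ 2) ((s ^ 3) ^ 2))⁻¹) := by
  have h := (summable_term hs ν).hasSum
  rwa [(h.prod_fiberwise (hasSum_term_fiber hs ν)).unique (hasSum_thetaSum hs ν hS)] at h

theorem term_eq_summand {ν : ℕ} (s : ℂ) {x : ℕ × ℕ × (Fin ν → ℕ)} (hx : x ∈ indexSet ν) :
    term s x = summand (s ^ 2) x.1 x.2.1 x.2.2 := by
  obtain ⟨i, m, n⟩ := x
  rw [term, core, if_pos (two_dvd_sub hx), summand, ← pow_mul s 2 (_ / 2),
    Nat.mul_div_cancel' (two_dvd_twiceExponent hx), twiceExponent, ← pow_mul s 2 3,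
    ← pow_mul s 3 2]
  simp only [mul_add, pow_add, pow_mul s 3]
  ring_nf

theorem term_eq_zero {ν : ℕ} (s : ℂ) {x : ℕ × ℕ × (Fin ν → ℕ)} (hx : x ∉ indexSet ν) :
    term s x = 0 := by
  obtain ⟨i, m, n⟩ := x
  rw [term, core, if_neg, mul_zero, mul_zero]
  intro h
  apply hx
  change (i + m) % 2 = sumTails n ν % 2
  simp only at h
  omega

end CapparelliHierarchy

theorem mainTheorem5 (ν : ℕ) (hν : 0 < ν) (C : ℕ) (hC : C = (ν + 2).choose 2)
    (q : ℂ) (hq : ‖q‖ < 1) :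
    HasSum
      (fun p : CapparelliHierarchy.indexSet ν =>
        CapparelliHierarchy.summand q p.1.1 p.1.2.1 p.1.2.2)
      (CapparelliHierarchy.qPochInf (q ^ (6 * C)) (q ^ (6 * C))
        * CapparelliHierarchy.qPochInf (-q ^ (3 * C + 1)) (q ^ (6 * C))
        * CapparelliHierarchy.qPochInf (-q ^ (3 * C - 1)) (q ^ (6 * C))
        / CapparelliHierarchy.qPochInf (q ^ 3) (q ^ 3)) := by
  -- A square root of q makes the half-integral powers in the separate factors meaningful; only
  -- their product is a power of q.
  obtain ⟨s, rfl⟩ : ∃ s : ℂ, s ^ 2 = q := IsAlgClosed.exists_pow_nat_eq q two_pos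
  obtain ⟨ν, rfl⟩ : ∃ k, ν = k + 1 := Nat.exists_eq_add_of_le' hν
  subst hC
  have hs : ‖s‖ < 1 := by
    rw [norm_pow] at hq
    exact (pow_lt_one_iff_of_nonneg (norm_nonneg s) two_ne_zero).1 hq
  have hC1 : 0 < (ν + 3).choose 2 := Nat.choose_pos (by omega)
  have hlt : ∀ k, k ≠ 0 → ‖(s ^ 2) ^ k‖ < 1 := fun k hk => by
    rw [norm_pow]; exact pow_lt_one₀ (norm_nonneg _) hq hk
  have h1 := CapparelliHierarchy.hasSum_theta (hlt (6 * (ν + 3).choose 2) (by omega))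
    (hlt (3 * (ν + 3).choose 2 + 1) (by omega)) (hlt (3 * (ν + 3).choose 2 - 1) (by omega))
    (by rw [← pow_add]; congr 1; omega)
  have h2 := CapparelliHierarchy.hasSum_term hs ν
    (h1.congr_fun fun j => CapparelliHierarchy.wt_mul_eq_theta s ν j)
  -- `term` vanishes where the parity condition fails, so the sum over all indices restricts to the
  -- index set.
  have h3 := (hasSum_subtype_iff_of_support_subset
    (s := CapparelliHierarchy.indexSet (ν + 1)) fun x hx => by
      by_contra h
      exact hx (CapparelliHierarchy.term_eq_zero s h)).2 h2
  rw [← pow_mul s 3 2, mul_comm 3 2, pow_mul s 2 3, ← div_eq_mul_inv] at h3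
  exact h3.congr_fun fun x => (CapparelliHierarchy.term_eq_summand s x.2).symm
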